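/- Let $(M,I,J,K)$ be a compact hypercomplex manifold: a compact Hausdorff smooth manifold with smooth integrable almost complex structures $I,J,K$ such that $IJ=-JI=K$. An endomorphism field $\mathcal I$ of $TM$ acts on $k$-forms by $\mathcal I\omega(X_1,\dots,X_k)=(-1)^k\omega(\mathcal IX_1,\dots,\mathcal IX_k)$, and $d_{\mathcal I}=(-1)^k\mathcal I d\mathcal I$ on $k$-forms. Let $A^2\subset\Lambda^2T^*M$ be the sum over all $\mathcal I=aI+bJ+cK$, $a^2+b^2+c^2=1$, of the real forms of type $(2,0)+(0,2)$ with respect to $\mathcal I$, let $B^2$ be the intersection of the spaces of real forms of type $(1,1)$ with respect to all these $\mathcal I$, so that $\Lambda^2T^*M=A^2\oplus B^2$, and let $\eta\colon\Lambda^2T^*M\to A^2$ be the projection with kernel $B^2$. The Salamon differential is $D=d$ on functions and $D=\eta\circ d$ on $1$-forms; put $D_I\varphi=ID\,I\varphi=I\,d\varphi$ for functions $\varphi$. A hyperhermitian metric is a smooth nondegenerate symmetric bilinear form $g$ on $TM$, of any signature, that is invariant under $I$, $J$ and $K$; put $F_{\mathcal I}=g(\mathcal I\cdot,\cdot)$ and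 $F=F_I$. It is HKT if $I\,dF_I=J\,dF_J=K\,dF_K$. Assume that the global $dd_I$-lemma holds on $M$: every $d$-exact smooth real $2$-form of type $(1,1)$ with respect to $I$ equals $dd_I\varphi$ for some smooth function $\varphi\colon M\to\mathbb R$. Let $g,g'$ be two HKT metrics with forms $F=F_I$, $F'=F'_I$ and the same Salamon cohomology class $[F]=[F']$, that is, $F-F'=D\theta$ for some smooth $1$-form $\theta$. Then: 1. there is a smooth function $\varphi\colon M\to\mathbb R$ with $F'=F+DD_I\varphi$; 2. if $M$ is connected, this $\varphi$ is unique up to an additive constant; 3. every smooth function $\varphi\colon M\to\mathbb R$ with $DD_I\varphi=0$ satisfies $\Delta^c\varphi=0$, where $\Delta^c f=g(dd_If,F_I)$ (the inner product of $2$-forms induced by $g$). -/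

import Mathlib

open scoped Manifold ContDiff Topology

noncomputable section

set_option linter.unusedSectionVars false

namespace HKT

/-! ## Linear algebra on one tangent space -/

section Pointwise

variable {V : Type*} [AddCommGroup V] [Module ℝ V] [TopologicalSpace V]
  [IsTopologicalAddGroup V] [ContinuousConstSMul ℝ V]

/-- The action of an endomorphism `S` on `k`-forms:
`(S α)(X₁, …, X_k) = (-1)^k α(S X₁, …, S X_k)`. -/
def act {k : ℕ} (S : V →L[ℝ] V) (α : V [⋀^Fin k]→L[ℝ] ℝ) : V [⋀^Fin k]→L[ℝ] ℝ :=
  ((-1 : ℝ) ^ k) • α.compContinuousLinearMap S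

/-- The `2`-sphere of complex structures `a I + b J + c K`, `a² + b² + c² = 1`. -/
def sphere (I J K : V →L[ℝ] V) : Set (V →L[ℝ] V) :=
  {S | ∃ a b c : ℝ, a ^ 2 + b ^ 2 + c ^ 2 = 1 ∧ S = a • I + b • J + c • K}

/-- The real `2`-forms of type `(2,0) + (0,2)` with respect to `S`
(a real `2`-form has this type iff `S α = -α`). -/
def typeTwoZero (S : V →L[ℝ] V) : Submodule ℝ (V [⋀^Fin 2]→L[ℝ] ℝ) where
  carrier := {α | act S α = -α}
  zero_mem' := by ext v; simp [act]
  add_mem' := by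
    intro α β hα hβ
    ext v
    have h1 := congrArg (fun f => f v) hα
    have h2 := congrArg (fun f => f v) hβ
    simp [act] at h1 h2 ⊢
    linarith
  smul_mem' := by
    intro r α hα
    ext v
    have h1 := congrArg (fun f => f v) hα
    simp [act] at h1 ⊢
    rw [h1]; ring

/-- The real `2`-forms of type `(1,1)` with respect to `S`
(a real `2`-form has this type iff `S α = α`). -/
def typeOneOne (S : V →L[ℝ] V) : Submodule ℝ (V [⋀^Fin 2]→L[ℝ] ℝ) where
  carrier := {α | act S α = α}
  zero_mem' := by ext v; simp [act]
  add_mem' := by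
    intro α β hα hβ
    ext v
    have h1 := congrArg (fun f => f v) hα
    have h2 := congrArg (fun f => f v) hβ
    simp [act] at h1 h2 ⊢
    linarith
  smul_mem' := by
    intro r α hα
    ext v
    have h1 := congrArg (fun f => f v) hα
    simp [act] at h1 ⊢
    rw [h1]; simp

/-- Salamon's space `A² = ∑_S (Λ^{2,0}_S ⊕ Λ^{0,2}_S)` (its real forms). -/
def salamonA (I J K : V →L[ℝ] V) : Submodule ℝ (V [⋀^Fin 2]→L[ℝ] ℝ) :=
  ⨆ S ∈ sphere I J K, typeTwoZero S

/-- The complement `B² = ⋂_S Λ^{1,1}_S` of `A²` (its real forms). -/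
def salamonB (I J K : V →L[ℝ] V) : Submodule ℝ (V [⋀^Fin 2]→L[ℝ] ℝ) :=
  ⨅ S ∈ sphere I J K, typeOneOne S

/-- The projection `η : Λ² → A²` with kernel `B²`, by its explicit formula; that this is
the projection is `salamonProj_mem`, `sub_salamonProj_mem` and `disjoint_salamonA_salamonB`. -/
def salamonProj (I J K : V →L[ℝ] V) (α : V [⋀^Fin 2]→L[ℝ] ℝ) : V [⋀^Fin 2]→L[ℝ] ℝ :=
  (1 / 4 : ℝ) • ((3 : ℝ) • α - act I α - act J α - act K α)

/-- `I, J, K` satisfy the quaternion relations. -/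
structure IsQuaternionic (I J K : V →L[ℝ] V) : Prop where
  I_sq : ∀ v, I (I v) = -v
  J_sq : ∀ v, J (J v) = -v
  K_sq : ∀ v, K (K v) = -v
  I_J : ∀ v, I (J v) = K v
  J_I : ∀ v, J (I v) = -K v

section Lemmas

variable {I J K : V →L[ℝ] V}

theorem act_two_apply (S : V →L[ℝ] V) (α : V [⋀^Fin 2]→L[ℝ] ℝ) (x y : V) :
    act S α ![x, y] = α ![S x, S y] := by
  have : (⇑S ∘ ![x, y] : Fin 2 → V) = ![S x, S y] := by
    ext i; fin_cases i <;> rfl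
  simp [act, this]

theorem form_ext {α β : V [⋀^Fin 2]→L[ℝ] ℝ} (h : ∀ x y, α ![x, y] = β ![x, y]) : α = β := by
  ext v
  have : v = ![v 0, v 1] := by ext i; fin_cases i <;> rfl
  rw [this]; exact h _ _

theorem form_add_left (α : V [⋀^Fin 2]→L[ℝ] ℝ) (x x' y : V) :
    α ![x + x', y] = α ![x, y] + α ![x', y] := by
  have e : ∀ z, Function.update ![x, y] 0 z = ![z, y] := fun z => by
    ext i; fin_cases i <;> rfl
  have h := α.map_update_add ![x, y] 0 x x'
  rwa [e, e, e] at h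

theorem form_smul_left (α : V [⋀^Fin 2]→L[ℝ] ℝ) (r : ℝ) (x y : V) :
    α ![r • x, y] = r * α ![x, y] := by
  have e : ∀ z, Function.update ![x, y] 0 z = ![z, y] := fun z => by
    ext i; fin_cases i <;> rfl
  have h := α.map_update_smul ![x, y] 0 r x
  rwa [e, e] at h

theorem form_swap (α : V [⋀^Fin 2]→L[ℝ] ℝ) (x y : V) : α ![x, y] = -α ![y, x] := by
  have h := α.toAlternatingMap.map_swap ![y, x] (i := 0) (j := 1) (by decide)
  have e : (![y, x] ∘ Equiv.swap (0 : Fin 2) 1) = ![x, y] := by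
    ext i; fin_cases i <;> simp
  rw [e] at h
  exact h

theorem form_add_right (α : V [⋀^Fin 2]→L[ℝ] ℝ) (x y y' : V) :
    α ![x, y + y'] = α ![x, y] + α ![x, y'] := by
  rw [form_swap, form_add_left, form_swap α x y, form_swap α x y']; ring

theorem form_smul_right (α : V [⋀^Fin 2]→L[ℝ] ℝ) (r : ℝ) (x y : V) :
    α ![x, r • y] = r * α ![x, y] := by
  rw [form_swap, form_smul_left, form_swap α x y]; ring

theorem form_neg_left (α : V [⋀^Fin 2]→L[ℝ] ℝ) (x y : V) : α ![-x, y] = -α ![x, y] := by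
  have h := form_smul_left α (-1) x y
  simpa using h

theorem form_neg_right (α : V [⋀^Fin 2]→L[ℝ] ℝ) (x y : V) : α ![x, -y] = -α ![x, y] := by
  have h := form_smul_right α (-1) x y
  simpa using h

theorem IsQuaternionic.J_K (h : IsQuaternionic I J K) (v : V) : J (K v) = I v := by
  have := h.J_I (J v)
  rw [h.I_J] at this
  rw [this, ← h.I_J, h.J_sq, map_neg, neg_neg]

theorem IsQuaternionic.K_J (h : IsQuaternionic I J K) (v : V) : K (J v) = -I v := by
  rw [← h.I_J, h.J_sq, map_neg]

theorem IsQuaternionic.K_I (h : IsQuaternionic I J K) (v : V) : K (I v) = J v := by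
  rw [← h.I_J, h.J_I, map_neg, ← h.I_J, h.I_sq, neg_neg]

theorem IsQuaternionic.I_K (h : IsQuaternionic I J K) (v : V) : I (K v) = -J v := by
  rw [← h.I_J, h.I_sq]

theorem salamonProj_mem (α : V [⋀^Fin 2]→L[ℝ] ℝ) (h : IsQuaternionic I J K) :
    salamonProj I J K α ∈ salamonA I J K := by
  have key : ∀ S : V →L[ℝ] V, S ∈ sphere I J K → (∀ v, S (S v) = -v) →
      α - act S α ∈ salamonA I J K := by
    intro S hS hSS
    refine Submodule.mem_iSup_of_mem S (Submodule.mem_iSup_of_mem hS ?_)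
    change act S (α - act S α) = -(α - act S α)
    refine form_ext fun x y => ?_
    simp only [act_two_apply, ContinuousAlternatingMap.sub_apply,
      ContinuousAlternatingMap.neg_apply, hSS, form_neg_left, form_neg_right]
    ring
  have e : salamonProj I J K α =
      (1 / 4 : ℝ) • ((α - act I α) + (α - act J α) + (α - act K α)) := by
    unfold salamonProj; module
  rw [e]
  refine Submodule.smul_mem _ _ (Submodule.add_mem _ (Submodule.add_mem _ ?_ ?_) ?_)
  · exact key I ⟨1, 0, 0, by norm_num, by simp⟩ h.I_sq
  · exact key J ⟨0, 1, 0, by norm_num, by simp⟩ h.J_sq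
  · exact key K ⟨0, 0, 1, by norm_num, by simp⟩ h.K_sq

theorem average_act (h : IsQuaternionic I J K) (α : V [⋀^Fin 2]→L[ℝ] ℝ) {S : V →L[ℝ] V}
    (hS : S ∈ sphere I J K) :
    act S α + act I (act S α) + act J (act S α) + act K (act S α) =
      α + act I α + act J α + act K α := by
  obtain ⟨a, b, c, habc, rfl⟩ := hS
  refine form_ext fun x y => ?_
  simp only [act_two_apply, ContinuousAlternatingMap.add_apply, add_apply,
    smul_apply, form_add_left, form_add_right, form_smul_left,
    form_smul_right, form_neg_left, form_neg_right,
    h.I_sq, h.J_sq, h.K_sq, h.I_J, h.J_I, h.J_K, h.K_J, h.K_I, h.I_K]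
  have hc : c ^ 2 = 1 - a ^ 2 - b ^ 2 := by linarith
  ring_nf
  rw [hc]
  ring

theorem act_average (h : IsQuaternionic I J K) (α : V [⋀^Fin 2]→L[ℝ] ℝ) {S : V →L[ℝ] V}
    (hS : S ∈ sphere I J K) :
    act S (α + act I α + act J α + act K α) = α + act I α + act J α + act K α := by
  obtain ⟨a, b, c, habc, rfl⟩ := hS
  refine form_ext fun x y => ?_
  simp only [act_two_apply, ContinuousAlternatingMap.add_apply, add_apply,
    smul_apply, form_add_left, form_add_right, form_smul_left,
    form_smul_right, form_neg_left, form_neg_right,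
    h.I_sq, h.J_sq, h.K_sq, h.I_J, h.J_I, h.J_K, h.K_J, h.K_I, h.I_K]
  have hc : c ^ 2 = 1 - a ^ 2 - b ^ 2 := by linarith
  ring_nf
  rw [hc]
  ring

theorem sub_salamonProj_mem (h : IsQuaternionic I J K) (α : V [⋀^Fin 2]→L[ℝ] ℝ) :
    α - salamonProj I J K α ∈ salamonB I J K := by
  have e : α - salamonProj I J K α = (1 / 4 : ℝ) • (α + act I α + act J α + act K α) := by
    unfold salamonProj; module
  rw [e]
  refine Submodule.smul_mem _ _ ?_
  simp only [salamonB, Submodule.mem_iInf]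
  exact fun S hS => act_average h α hS

theorem disjoint_salamonA_salamonB (h : IsQuaternionic I J K) :
    Disjoint (salamonA I J K) (salamonB I J K) := by
  rw [Submodule.disjoint_def]
  intro α hA hB
  simp only [salamonB, Submodule.mem_iInf] at hB
  have hI : act I α = α := hB I ⟨1, 0, 0, by norm_num, by simp⟩
  have hJ : act J α = α := hB J ⟨0, 1, 0, by norm_num, by simp⟩
  have hK : act K α = α := hB K ⟨0, 0, 1, by norm_num, by simp⟩
  have hN : α + act I α + act J α + act K α = 0 := by
    clear hI hJ hK hB
    have hle : salamonA I J K ≤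
        { carrier := {β | ∀ x y, (β + act I β + act J β + act K β) ![x, y] = 0}
          zero_mem' := by intro x y; simp [act]
          add_mem' := by
            intro β γ hβ hγ x y
            have h1 := hβ x y
            have h2 := hγ x y
            simp only [ContinuousAlternatingMap.add_apply, act_two_apply] at h1 h2 ⊢
            linarith
          smul_mem' := by
            intro r β hβ x y
            have h1 := hβ x y
            simp only [ContinuousAlternatingMap.add_apply, act_two_apply,
              ContinuousAlternatingMap.smul_apply, smul_eq_mul] at h1 ⊢
            linear_combination r * h1 : Submodule ℝ (V [⋀^Fin 2]→L[ℝ] ℝ) } := by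
      refine iSup_le fun S => iSup_le fun hS => ?_
      intro β hβ x y
      have hβ' : act S β = -β := hβ
      have h1 := congrArg (fun f => f ![x, y]) (average_act h β hS)
      rw [hβ'] at h1
      simp only [ContinuousAlternatingMap.add_apply, act_two_apply,
        ContinuousAlternatingMap.neg_apply] at h1 ⊢
      linarith
    exact form_ext fun x y => by simpa using hle hA x y
  rw [hI, hJ, hK] at hN
  have : (4 : ℝ) • α = 0 := by rw [← hN]; module
  simpa using this

end Lemmas

/-- The inner product `½ g^{ik} g^{jl} α_{ij} β_{kl}` induced by the nondegenerate symmetric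
form `g` on `2`-forms, in components with respect to a basis `b`. -/
def innerTwoForm {ι : Type*} [Fintype ι] [DecidableEq ι] (b : Module.Basis ι ℝ V)
    (g : V →L[ℝ] V →L[ℝ] ℝ) (α β : V [⋀^Fin 2]→L[ℝ] ℝ) : ℝ :=
  let G : Matrix ι ι ℝ := (Matrix.of fun i j => g (b i) (b j))⁻¹
  (1 / 2) * ∑ i, ∑ j, ∑ k, ∑ l, G i k * G j l * α ![b i, b j] * β ![b k, b l]

end Pointwise

/-! ## Differential forms on a manifold -/

section Manifold

variable {E : Type*} [NormedAddCommGroup E] [NormedSpace ℝ E]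
  {M : Type*} [TopologicalSpace M] [ChartedSpace E M]

/-- Real `k`-forms on `M` (not necessarily smooth). -/
abbrev DForm (E : Type*) [NormedAddCommGroup E] [NormedSpace ℝ E]
    (M : Type*) [TopologicalSpace M] [ChartedSpace E M] (k : ℕ) : Type _ :=
  ∀ x : M, TangentSpace 𝓘(ℝ, E) x [⋀^Fin k]→L[ℝ] ℝ

/-- Fields of endomorphisms of the tangent bundle of `M` (not necessarily smooth). -/
abbrev EndField (E : Type*) [NormedAddCommGroup E] [NormedSpace ℝ E]
    (M : Type*) [TopologicalSpace M] [ChartedSpace E M] : Type _ :=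
  ∀ x : M, TangentSpace 𝓘(ℝ, E) x →L[ℝ] TangentSpace 𝓘(ℝ, E) x

/-- The form `α` written in the chart around `x₀`: its pullback under the inverse chart. -/
def inChart {k : ℕ} (α : DForm E M k) (x₀ : M) : E → E [⋀^Fin k]→L[ℝ] ℝ := fun y =>
  (α ((extChartAt 𝓘(ℝ, E) x₀).symm y)).compContinuousLinearMap
    (mfderiv 𝓘(ℝ, E) 𝓘(ℝ, E) (extChartAt 𝓘(ℝ, E) x₀).symm y)

theorem continuous_bilin (g : E →L[ℝ] E →L[ℝ] ℝ) (S : E →L[ℝ] E) :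
    Continuous fun v : Fin 2 → E => g (S (v 0)) (v 1) := by fun_prop

/-- The Kähler form `F_S = g(S ·, ·)` at `x`, a `2`-form once `g(S v, v) = 0` for all `v`. -/
def kahlerForm (x : M) (g : TangentSpace 𝓘(ℝ, E) x →L[ℝ] TangentSpace 𝓘(ℝ, E) x →L[ℝ] ℝ)
    (S : TangentSpace 𝓘(ℝ, E) x →L[ℝ] TangentSpace 𝓘(ℝ, E) x) (hS : ∀ v, g (S v) v = 0) :
    TangentSpace 𝓘(ℝ, E) x [⋀^Fin 2]→L[ℝ] ℝ where
  toFun v := g (S (v 0)) (v 1)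
  map_update_add' := by
    intro _ m i x y
    fin_cases i <;> simp
  map_update_smul' := by
    intro _ m i c x
    fin_cases i <;> simp
  cont := continuous_bilin (E := E) g S
  map_eq_zero_of_eq' := by
    intro v i j hij hne
    fin_cases i <;> fin_cases j <;> simp_all

/-- A form is smooth if it is smooth in every chart. -/
def IsSmoothForm {k : ℕ} (α : DForm E M k) : Prop :=
  ∀ x₀ : M, ContDiffOn ℝ ∞ (inChart α x₀) (extChartAt 𝓘(ℝ, E) x₀).target

/-- The exterior derivative, computed in the chart around each point. -/
def extD {k : ℕ} (α : DForm E M k) : DForm E M (k + 1) := fun x =>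
  (extDeriv (inChart α x) (extChartAt 𝓘(ℝ, E) x x)).compContinuousLinearMap
    (mfderiv 𝓘(ℝ, E) 𝓘(ℝ, E) (extChartAt 𝓘(ℝ, E) x) x)

/-- A function as a `0`-form. -/
def ofFun (φ : M → ℝ) : DForm E M 0 := fun x =>
  ContinuousAlternatingMap.constOfIsEmpty ℝ (TangentSpace 𝓘(ℝ, E) x) (Fin 0) (φ x)

/-- The action of an endomorphism field on forms. -/
def actForm {k : ℕ} (S : EndField E M) (α : DForm E M k) : DForm E M k := fun x =>
  act (S x) (α x)

/-- The twisted differential `d_S α = (-1)^k S d S α` of a `k`-form. -/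
def twistedD {k : ℕ} (S : EndField E M) (α : DForm E M k) : DForm E M (k + 1) :=
  ((-1 : ℝ) ^ k) • actForm S (extD (actForm S α))

variable [IsManifold 𝓘(ℝ, E) ∞ M]

/-- A smooth vector field. -/
def IsSmoothVectorField (X : ∀ x : M, TangentSpace 𝓘(ℝ, E) x) : Prop :=
  ContMDiff 𝓘(ℝ, E) 𝓘(ℝ, E).tangent ∞ (fun x => (⟨x, X x⟩ : TangentBundle 𝓘(ℝ, E) M))

/-- Integrability of an almost complex structure: its Nijenhuis tensor vanishes. -/
def IsIntegrable (S : EndField E M) : Prop :=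
  ∀ X Y : (∀ x : M, TangentSpace 𝓘(ℝ, E) x), IsSmoothVectorField X → IsSmoothVectorField Y →
    ∀ x : M,
      VectorField.mlieBracket 𝓘(ℝ, E) (fun z => S z (X z)) (fun z => S z (Y z)) x
        - S x (VectorField.mlieBracket 𝓘(ℝ, E) (fun z => S z (X z)) Y x)
        - S x (VectorField.mlieBracket 𝓘(ℝ, E) X (fun z => S z (Y z)) x)
        - VectorField.mlieBracket 𝓘(ℝ, E) X Y x = 0

/-- A smooth field of endomorphisms of the tangent bundle. -/
def IsSmoothEndField (S : EndField E M) : Prop :=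
  ContMDiff 𝓘(ℝ, E) (𝓘(ℝ, E).prod 𝓘(ℝ, E →L[ℝ] E)) ∞
    (fun x => Bundle.TotalSpace.mk' (E →L[ℝ] E)
      (E := fun x : M => TangentSpace 𝓘(ℝ, E) x →L[ℝ] TangentSpace 𝓘(ℝ, E) x) x (S x))

/-- A hypercomplex structure: smooth integrable almost complex structures `I, J, K` with
`I J = -J I = K`. -/
structure HypercomplexStructure (E : Type*) [NormedAddCommGroup E] [NormedSpace ℝ E]
    (M : Type*) [TopologicalSpace M] [ChartedSpace E M] [IsManifold 𝓘(ℝ, E) ∞ M] where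
  I : EndField E M
  J : EndField E M
  K : EndField E M
  quaternionic : ∀ x, IsQuaternionic (I x) (J x) (K x)
  smooth_I : IsSmoothEndField I
  smooth_J : IsSmoothEndField J
  smooth_K : IsSmoothEndField K
  integrable_I : IsIntegrable I
  integrable_J : IsIntegrable J
  integrable_K : IsIntegrable K

/-- The Salamon differential `D` on functions: `D = d`, as `A¹ = Λ¹` and `η = id` there. -/
def salamonD₀ (α : DForm E M 0) : DForm E M 1 := extD α

namespace HypercomplexStructure

variable (h : HypercomplexStructure E M)

/-- The Salamon differential `D = η ∘ d` from `1`-forms (`A¹ = Λ¹`) to sections of `A²`. -/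
def salamonD₁ (θ : DForm E M 1) : DForm E M 2 := fun x =>
  salamonProj (h.I x) (h.J x) (h.K x) (extD θ x)

/-- The operator `D_I = (-1)^k I D I` on functions (`k = 0`). -/
def salamonDI (α : DForm E M 0) : DForm E M 1 :=
  ((-1 : ℝ) ^ 0) • actForm h.I (salamonD₀ (actForm h.I α))

/-- `D D_I φ` for a function `φ`. -/
def DDI (φ : M → ℝ) : DForm E M 2 := h.salamonD₁ (h.salamonDI (ofFun φ))

/-- `d d_I φ` for a function `φ`. -/
def ddI (φ : M → ℝ) : DForm E M 2 := extD (twistedD h.I (ofFun φ))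

/-- The global `d d_I`-lemma: every exact real `2`-form which is of type `(1,1)` with respect to
`I` is `d d_I φ` for a globally defined smooth real function `φ`. -/
def GlobalDDILemma : Prop :=
  ∀ θ : DForm E M 1, IsSmoothForm θ → (∀ x, extD θ x ∈ typeOneOne (h.I x)) →
    ∃ φ : M → ℝ, ContMDiff 𝓘(ℝ, E) 𝓘(ℝ) ∞ φ ∧ extD θ = h.ddI φ

/-- Two `2`-forms define the same Salamon cohomology class: their difference is `D θ` for a
smooth `1`-form `θ`. -/
def SameSalamonClass (F F' : DForm E M 2) : Prop :=
  ∃ θ : DForm E M 1, IsSmoothForm θ ∧ F - F' = h.salamonD₁ θ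

end HypercomplexStructure

/-- A smooth hyperhermitian (pseudo-)metric: a smooth nondegenerate symmetric bilinear form,
of any signature, invariant under `I`, `J` and `K`. -/
structure HyperhermitianMetric (h : HypercomplexStructure E M) where
  g : ∀ x : M, TangentSpace 𝓘(ℝ, E) x →L[ℝ] TangentSpace 𝓘(ℝ, E) x →L[ℝ] ℝ
  smooth : ContMDiff 𝓘(ℝ, E) (𝓘(ℝ, E).prod 𝓘(ℝ, E →L[ℝ] E →L[ℝ] ℝ)) ∞
    (fun x => Bundle.TotalSpace.mk' (E →L[ℝ] E →L[ℝ] ℝ)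
      (E := fun x : M => TangentSpace 𝓘(ℝ, E) x →L[ℝ] TangentSpace 𝓘(ℝ, E) x →L[ℝ] ℝ) x (g x))
  symm : ∀ x v w, g x v w = g x w v
  nondegenerate : ∀ x v, (∀ w, g x v w = 0) → v = 0
  inv_I : ∀ x v w, g x (h.I x v) (h.I x w) = g x v w
  inv_J : ∀ x v w, g x (h.J x v) (h.J x w) = g x v w
  inv_K : ∀ x v w, g x (h.K x v) (h.K x w) = g x v w

namespace HyperhermitianMetric

variable {h : HypercomplexStructure E M} (g : HyperhermitianMetric h)

theorem apply_eq_zero (x : M)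
    (S : TangentSpace 𝓘(ℝ, E) x →L[ℝ] TangentSpace 𝓘(ℝ, E) x) (hS : ∀ v, S (S v) = -v)
    (hg : ∀ v w, g.g x (S v) (S w) = g.g x v w) (v : TangentSpace 𝓘(ℝ, E) x) :
    g.g x (S v) v = 0 := by
  have h1 := hg (S v) v
  rw [hS, map_neg, neg_apply, g.symm x v (S v)] at h1
  linarith

/-- The Kähler form `F_I`, which is the HKT form `F`. -/
def FI : DForm E M 2 := fun x => kahlerForm x (g.g x) (h.I x)
  (g.apply_eq_zero x (h.I x) (h.quaternionic x).I_sq (g.inv_I x))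

/-- The Kähler form `F_J`. -/
def FJ : DForm E M 2 := fun x => kahlerForm x (g.g x) (h.J x)
  (g.apply_eq_zero x (h.J x) (h.quaternionic x).J_sq (g.inv_J x))

/-- The Kähler form `F_K`. -/
def FK : DForm E M 2 := fun x => kahlerForm x (g.g x) (h.K x)
  (g.apply_eq_zero x (h.K x) (h.quaternionic x).K_sq (g.inv_K x))

/-- The HKT condition `I dF_I = J dF_J = K dF_K`. -/
def IsHKT : Prop :=
  actForm h.I (extD g.FI) = actForm h.J (extD g.FJ) ∧
    actForm h.J (extD g.FJ) = actForm h.K (extD g.FK)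

/-- The complex Laplacian `Δ^c f = g(d d_I f, F_I)`. -/
def complexLaplacian [FiniteDimensional ℝ E] (f : M → ℝ) (x : M) : ℝ :=
  haveI : Module.Finite ℝ (TangentSpace 𝓘(ℝ, E) x) := inferInstanceAs (Module.Finite ℝ E)
  innerTwoForm (Module.finBasis ℝ (TangentSpace 𝓘(ℝ, E) x)) (g.g x) (h.ddI f x) (g.FI x)

end HyperhermitianMetric

end Manifold

end HKT

end

/-!
Everything rests on the decomposition `Λ² = A² ⊕ B²`, in which `B²` is the space of forms invariant
under every complex structure of the sphere, and on `D D_I φ = η (d d_I φ)`.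

*Existence.* `F - F' = η (dθ)` is invariant under `I`, and so is the `B²`-component of `dθ`. Hence
`dθ` itself is of type `(1,1)` for `I` (`mem_typeOneOne_of_salamonProj_mem`). The `d d_I`-lemma
gives `-dθ = d d_I φ`, and applying `η` yields `F' - F = D D_I φ` (`exists_potential`).

*Laplacian.* If `D D_I φ = 0`, then `d d_I φ` lies in `B²`, so it is invariant under `J`, whereas
`F_I` changes sign under `J`. As `J` is an isometry of `g`, the two forms are orthogonal
(`innerTwoForm_eq_zero`), whatever the signature of `g`.

*Uniqueness.* The metric may be indefinite, so its Laplacian need not be elliptic and is not used.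
If `D D_I f = 0`, the invariance of `d d_I f` under `J` and `I J = - J I` give
`d d_I f (X, I X) + d d_I f (J X, I J X) = 0` for every vector `X`
(`HypercomplexStructure.extDeriv_twistedD_add_eq_zero`). In a chart, `d d_I f (X, I X)` is
`D²f (X, X) + D²f (I X, I X)` up to first-order terms, so the sum of these identities over a basis
is a linear elliptic equation without zeroth-order term. By Hopf's strong maximum principle
(`isOpen_maximum_set`) the set where `f` attains its maximum is open, so `f` is constant on a
compact connected manifold (`HypercomplexStructure.exists_eq_const_of_DDI_eq_zero`). The passage to
a chart uses that the exterior derivative is the same in every chart (`extD_apply_of_mem_source`).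
-/

namespace HKT

/-! ### Trace pairings of matrices -/

section Trace

variable {ι : Type*} [Fintype ι]

theorem sum_four_eq_trace (S A B : Matrix ι ι ℝ) :
    ∑ i, ∑ j, ∑ k, ∑ l, S i k * S j l * A i j * B k l
      = Matrix.trace (S.transpose * A * S * B.transpose) := by
  have h1 : Matrix.trace (S.transpose * A * S * B.transpose)
      = ∑ k, ∑ l, ∑ j, ∑ i, S i k * S j l * A i j * B k l := by
    simp only [Matrix.trace, Matrix.diag, Matrix.mul_apply, Matrix.transpose_apply,
      Finset.sum_mul]
    refine Finset.sum_congr rfl fun k _ => Finset.sum_congr rfl fun l _ =>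
      Finset.sum_congr rfl fun j _ => Finset.sum_congr rfl fun i _ => by ring
  rw [h1]
  calc _ = ∑ i, ∑ k, ∑ j, ∑ l, S i k * S j l * A i j * B k l :=
        Finset.sum_congr rfl fun i _ => Finset.sum_comm
    _ = ∑ k, ∑ i, ∑ j, ∑ l, S i k * S j l * A i j * B k l := Finset.sum_comm
    _ = ∑ k, ∑ i, ∑ l, ∑ j, S i k * S j l * A i j * B k l :=
        Finset.sum_congr rfl fun k _ => Finset.sum_congr rfl fun i _ => Finset.sum_comm
    _ = ∑ k, ∑ l, ∑ i, ∑ j, S i k * S j l * A i j * B k l :=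
        Finset.sum_congr rfl fun k _ => Finset.sum_comm
    _ = _ := Finset.sum_congr rfl fun k _ => Finset.sum_congr rfl fun l _ => Finset.sum_comm

variable [DecidableEq ι]

/-- The trace pairing defined by an invertible matrix `G` fixed by the congruence with `P`
pairs matrices fixed by that congruence trivially with matrices changing sign under it. -/
theorem trace_eq_zero_of_congruence {G P A B : Matrix ι ι ℝ} (hG : IsUnit G.det)
    (hP : P.transpose * G * P = G) (hA : P.transpose * A * P = A)
    (hB : P.transpose * B * P = -B) :
    Matrix.trace (G⁻¹.transpose * A * G⁻¹ * B.transpose) = 0 := by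
  have hPu : IsUnit P.det := by
    have := congrArg Matrix.det hP
    rw [Matrix.det_mul] at this
    exact isUnit_of_mul_isUnit_right (this ▸ hG)
  have hPt : IsUnit P.transpose.det := by rwa [Matrix.det_transpose]
  have hS : G⁻¹ = P * G⁻¹ * P.transpose := by
    refine Matrix.inv_eq_left_inv ?_
    have h1 : P.transpose * G = G * P⁻¹ := by
      rw [← Matrix.mul_nonsing_inv_cancel_right P (P.transpose * G) hPu, hP]
    rw [Matrix.mul_assoc, h1, Matrix.mul_assoc, ← Matrix.mul_assoc G⁻¹,
      Matrix.nonsing_inv_mul _ hG, Matrix.one_mul, Matrix.mul_nonsing_inv _ hPu]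
  have hSt : G⁻¹.transpose = P * G⁻¹.transpose * P.transpose := by
    conv_lhs => rw [hS]
    simp [Matrix.transpose_mul, Matrix.mul_assoc]
  have hBt : P.transpose * B.transpose * P = -B.transpose := by
    rw [← Matrix.transpose_neg, ← hB]
    simp [Matrix.transpose_mul, Matrix.mul_assoc]
  have key : Matrix.trace (G⁻¹.transpose * A * G⁻¹ * B.transpose)
      = -Matrix.trace (G⁻¹.transpose * A * G⁻¹ * B.transpose) := by
    calc Matrix.trace (G⁻¹.transpose * A * G⁻¹ * B.transpose)
        = Matrix.trace (P * G⁻¹.transpose * P.transpose * A * (P * G⁻¹ * P.transpose)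
            * B.transpose) := by rw [← hS, ← hSt]
      _ = Matrix.trace (P * (G⁻¹.transpose * (P.transpose * A * P) * G⁻¹
            * P.transpose * B.transpose)) := by simp only [Matrix.mul_assoc]
      _ = Matrix.trace (G⁻¹.transpose * A * G⁻¹ * (P.transpose * B.transpose * P)) := by
          rw [Matrix.trace_mul_comm, hA]; simp only [Matrix.mul_assoc]
      _ = _ := by rw [hBt, Matrix.mul_neg, Matrix.trace_neg]
  linarith

variable {V : Type*} [AddCommGroup V] [Module ℝ V]

/-- The matrix form of the invariance, up to the factor `c`, of a bilinear map `γ` under `J`. -/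
theorem transpose_toMatrix_mul_mul (b : Module.Basis ι ℝ V) (J : V →ₗ[ℝ] V) (c : ℝ)
    (γ : V → V → ℝ) (hadd : ∀ x x' y, γ (x + x') y = γ x y + γ x' y)
    (hsmul : ∀ (r : ℝ) x y, γ (r • x) y = r * γ x y)
    (hadd' : ∀ x y y', γ x (y + y') = γ x y + γ x y')
    (hsmul' : ∀ (r : ℝ) x y, γ x (r • y) = r * γ x y)
    (hJ : ∀ x y, γ (J x) (J y) = c * γ x y) :
    (LinearMap.toMatrix b b J).transpose * Matrix.of (fun i j => γ (b i) (b j))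
      * LinearMap.toMatrix b b J = c • Matrix.of (fun i j => γ (b i) (b j)) := by
  let Γ : LinearMap.BilinForm ℝ V := LinearMap.mk₂ ℝ γ hadd hsmul hadd' hsmul'
  have hΓ : Matrix.of (fun i j => γ (b i) (b j)) = LinearMap.BilinForm.toMatrix b Γ := by
    ext i j; simp [Γ, LinearMap.BilinForm.toMatrix_apply]
  rw [hΓ, ← LinearMap.BilinForm.toMatrix_comp, ← map_smul]
  congr 1
  ext x y
  simpa [Γ] using hJ x y

end Trace

/-! ### Linear algebra of two-forms -/

section TwoForms

variable {V : Type*} [AddCommGroup V] [Module ℝ V] [TopologicalSpace V]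
  [IsTopologicalAddGroup V] [ContinuousConstSMul ℝ V] {I J K : V →L[ℝ] V}

theorem I_mem_sphere (I J K : V →L[ℝ] V) : I ∈ sphere I J K :=
  ⟨1, 0, 0, by norm_num, by simp⟩

theorem J_mem_sphere (I J K : V →L[ℝ] V) : J ∈ sphere I J K :=
  ⟨0, 1, 0, by norm_num, by simp⟩

theorem act_eq_of_mem_salamonB {α : V [⋀^Fin 2]→L[ℝ] ℝ} (hα : α ∈ salamonB I J K)
    {S : V →L[ℝ] V} (hS : S ∈ sphere I J K) : act S α = α := by
  simp only [salamonB, Submodule.mem_iInf] at hα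
  exact hα S hS

/-- A two-form with vanishing `A²`-component is its own `B²`-component. -/
theorem mem_salamonB_of_salamonProj_eq_zero (h : IsQuaternionic I J K)
    {α : V [⋀^Fin 2]→L[ℝ] ℝ} (hα : salamonProj I J K α = 0) : α ∈ salamonB I J K := by
  simpa [hα] using sub_salamonProj_mem h α

/-- Since the `B²`-component of `α` is of type `(1,1)` anyway, `α` is of type `(1,1)` with respect
to `I` as soon as its `A²`-component is. -/
theorem mem_typeOneOne_of_salamonProj_mem (h : IsQuaternionic I J K)
    {α : V [⋀^Fin 2]→L[ℝ] ℝ} (hα : salamonProj I J K α ∈ typeOneOne I) : α ∈ typeOneOne I := by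
  have hB : α - salamonProj I J K α ∈ typeOneOne I :=
    act_eq_of_mem_salamonB (sub_salamonProj_mem h α) (I_mem_sphere I J K)
  simpa using Submodule.add_mem _ hB hα

theorem salamonProj_sub (α β : V [⋀^Fin 2]→L[ℝ] ℝ) :
    salamonProj I J K (α - β) = salamonProj I J K α - salamonProj I J K β := by
  refine form_ext fun x y => ?_
  simp only [salamonProj, act_two_apply, ContinuousAlternatingMap.sub_apply,
    ContinuousAlternatingMap.smul_apply, smul_eq_mul]
  ring

theorem salamonProj_neg (α : V [⋀^Fin 2]→L[ℝ] ℝ) :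
    salamonProj I J K (-α) = -salamonProj I J K α := by
  refine form_ext fun x y => ?_
  simp only [salamonProj, act_two_apply, ContinuousAlternatingMap.sub_apply,
    ContinuousAlternatingMap.smul_apply, ContinuousAlternatingMap.neg_apply, smul_eq_mul]
  ring

/-- Forms that are invariant under an isometry `J` of `g` are orthogonal to forms that change
sign under it. -/
theorem innerTwoForm_eq_zero {ι : Type*} [Fintype ι] [DecidableEq ι] (b : Module.Basis ι ℝ V)
    (g : V →L[ℝ] V →L[ℝ] ℝ)
    (hg : ∀ v, (∀ w, g v w = 0) → v = 0) (hgJ : ∀ v w, g (J v) (J w) = g v w)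
    {α β : V [⋀^Fin 2]→L[ℝ] ℝ} (hα : act J α = α) (hβ : act J β = -β) :
    innerTwoForm b g α β = 0 := by
  have hα' : ∀ x y, α ![J x, J y] = 1 * α ![x, y] := fun x y => by
    rw [← act_two_apply, hα, one_mul]
  have hβ' : ∀ x y, β ![J x, J y] = (-1) * β ![x, y] := fun x y => by
    rw [← act_two_apply, hβ]; simp
  have hA := transpose_toMatrix_mul_mul b J 1 (fun x y => α ![x, y]) (form_add_left α)
    (form_smul_left α) (form_add_right α) (form_smul_right α) hα'
  have hB := transpose_toMatrix_mul_mul b J (-1) (fun x y => β ![x, y]) (form_add_left β)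
    (form_smul_left β) (form_add_right β) (form_smul_right β) hβ'
  have hG := transpose_toMatrix_mul_mul b J 1 (fun x y => g x y) (by simp) (by simp) (by simp)
    (by simp) (fun x y => (hgJ x y).trans (one_mul _).symm)
  rw [one_smul] at hA hG
  rw [neg_one_smul] at hB
  have hdet : IsUnit (Matrix.of fun i j => g (b i) (b j)).det := by
    rw [isUnit_iff_ne_zero, Ne, ← Matrix.exists_vecMul_eq_zero_iff]
    rintro ⟨v, hv, h0⟩
    have hvec : ∑ i, v i • b i = 0 := by
      refine hg _ fun w => ?_
      have hbasis : ∀ j, g (∑ i, v i • b i) (b j) = 0 := fun j => by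
        have := congrFun h0 j
        simpa [Matrix.vecMul, dotProduct] using this
      have : (g (∑ i, v i • b i) : V →ₗ[ℝ] ℝ) = 0 := b.ext fun j => by simpa using hbasis j
      exact congrArg (fun f : V →ₗ[ℝ] ℝ => f w) this
    exact hv (funext fun i => Fintype.linearIndependent_iff.1 b.linearIndependent v hvec i)
  have := trace_eq_zero_of_congruence hdet hG hA hB
  rw [← sum_four_eq_trace] at this
  simp only [Matrix.of_apply] at this
  simp [innerTwoForm, this]

end TwoForms

/-! ### The strong maximum principle -/

section MaximumPrinciple

variable {F : Type*} [NormedAddCommGroup F] [NormedSpace ℝ F]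

/-- The restriction of `w` to a line through a local maximum has non-positive second derivative:
were it positive, the maximum would be a local minimum too, so the restriction would be locally
constant. -/
theorem fderiv_fderiv_nonpos_of_isLocalMax {w : F → ℝ} {y : F} (hw : ContDiffAt ℝ 2 w y)
    (hmax : IsLocalMax w y) (X : F) : fderiv ℝ (fderiv ℝ w) y X X ≤ 0 := by
  by_contra! hpos
  set l : ℝ → F := fun t => y + t • X with hl
  have hl0 : l 0 = y := by simp [hl]
  have hld : ∀ t, HasDerivAt l X t := fun t => by
    simpa [hl] using ((hasDerivAt_id t).smul_const X).const_add y
  have hlc : ContinuousAt l 0 := (hld 0).continuousAt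
  have hlt : Filter.Tendsto l (𝓝 0) (𝓝 y) := by simpa [hl0] using hlc.tendsto
  have hd : ∀ᶠ t in 𝓝 (0 : ℝ), deriv (w ∘ l) t = fderiv ℝ w (l t) X := by
    have h1 : ∀ᶠ x in 𝓝 y, ContDiffAt ℝ 2 w x := hw.eventually (by simp)
    filter_upwards [hlt.eventually h1] with t ht
    exact ((ht.differentiableAt (by simp)).hasFDerivAt.comp_hasDerivAt t (hld t)).deriv
  have hdd : deriv (deriv (w ∘ l)) 0 = fderiv ℝ (fderiv ℝ w) y X X := by
    rw [Filter.EventuallyEq.deriv_eq hd]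
    have h2 : DifferentiableAt ℝ (fderiv ℝ w) (l 0) := by
      rw [hl0]
      exact (hw.fderiv_right (m := 1) (by norm_num)).differentiableAt (by simp)
    have h3 := (h2.hasFDerivAt.comp_hasDerivAt (0 : ℝ) (hld 0)).clm_apply
      (hasDerivAt_const (0 : ℝ) X)
    have h4 := h3.deriv
    simp only [Function.comp_apply, map_zero, add_zero] at h4
    rw [h4, hl0]
  have hmax' : IsLocalMax (w ∘ l) 0 := by
    have := hlt.eventually hmax
    simpa [IsLocalMax, IsMaxFilter, hl0] using this
  have hmin : IsLocalMin (w ∘ l) 0 := by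
    refine isLocalMin_of_deriv_deriv_pos (hdd ▸ hpos) hmax'.deriv_eq_zero ?_
    exact ContinuousAt.comp (by rw [hl0]; exact hw.continuousAt) hlc
  have hconst : (w ∘ l) =ᶠ[𝓝 0] fun _ => (w ∘ l) 0 := by
    filter_upwards [hmax', hmin] with t h1 h2 using le_antisymm h1 h2
  have hzero : deriv (w ∘ l) =ᶠ[𝓝 0] fun _ => 0 := by
    simpa using hconst.deriv
  have := hzero.deriv_eq
  rw [hdd] at this
  simp at this
  linarith

variable {ι : Type*} [Fintype ι]

/-- The second-order operator `u ↦ ∑ᵢ D²u(Xᵢ, Xᵢ) + Du(b)` without zeroth-order term. -/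
noncomputable def secondOrderOp (X : ι → F → F) (b : F → F) (u : F → ℝ) (y : F) : ℝ :=
  ∑ i, fderiv ℝ (fderiv ℝ u) y (X i y) (X i y) + fderiv ℝ u y (b y)

theorem secondOrderOp_nonpos_of_isLocalMax {X : ι → F → F} {b : F → F} {w : F → ℝ} {y : F}
    (hw : ContDiffAt ℝ 2 w y) (hmax : IsLocalMax w y) : secondOrderOp X b w y ≤ 0 := by
  rw [secondOrderOp, hmax.fderiv_eq_zero]
  simpa using Finset.sum_nonpos fun i _ => fderiv_fderiv_nonpos_of_isLocalMax hw hmax (X i y)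

theorem secondOrderOp_add_const_mul {X : ι → F → F} {b : F → F} {u ψ : F → ℝ} {y : F}
    (hu : ContDiffAt ℝ 2 u y) (hψ : ContDiffAt ℝ 2 ψ y) (ε : ℝ) :
    secondOrderOp X b (fun x => u x + ε * ψ x) y
      = secondOrderOp X b u y + ε * secondOrderOp X b ψ y := by
  have h1 : ∀ᶠ x in 𝓝 y, fderiv ℝ (fun x => u x + ε * ψ x) x
      = fderiv ℝ u x + ε • fderiv ℝ ψ x := by
    filter_upwards [hu.eventually (by simp), hψ.eventually (by simp)] with x h1 h2
    have hd1 := h1.differentiableAt (by simp)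
    have hd2 := h2.differentiableAt (by simp)
    exact (hd1.hasFDerivAt.add (hd2.hasFDerivAt.const_mul ε)).fderiv
  have hd1 : DifferentiableAt ℝ (fderiv ℝ u) y :=
    (hu.fderiv_right (m := 1) (by norm_num)).differentiableAt (by simp)
  have hd2 : DifferentiableAt ℝ (fderiv ℝ ψ) y :=
    (hψ.fderiv_right (m := 1) (by norm_num)).differentiableAt (by simp)
  have h2 : fderiv ℝ (fderiv ℝ (fun x => u x + ε * ψ x)) y
      = fderiv ℝ (fderiv ℝ u) y + ε • fderiv ℝ (fderiv ℝ ψ) y := by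
    rw [Filter.EventuallyEq.fderiv_eq h1]
    exact (hd1.hasFDerivAt.add (hd2.hasFDerivAt.const_smul ε)).fderiv
  simp only [secondOrderOp, h2, h1.self_of_nhds, add_apply,
    smul_apply, smul_eq_mul, Finset.sum_add_distrib, ← Finset.mul_sum]
  ring

theorem continuousAt_secondOrderOp {X : ι → F → F} {b : F → F} {ψ : F → ℝ} {z : F}
    (hX : ∀ i, ContinuousAt (X i) z) (hb : ContinuousAt b z) (hψ : ContDiff ℝ 2 ψ) :
    ContinuousAt (secondOrderOp X b ψ) z := by
  have h1 : Continuous (fderiv ℝ ψ) := hψ.continuous_fderiv (by simp)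
  have h2 : Continuous (fderiv ℝ (fderiv ℝ ψ)) :=
    (hψ.fderiv_right (m := 1) (by norm_num)).continuous_fderiv (by simp)
  refine ContinuousAt.add (tendsto_finsetSum _ fun i _ => ?_) ?_
  · exact (h2.continuousAt.clm_apply (hX i)).clm_apply (hX i)
  · exact h1.continuousAt.clm_apply hb

/-- The barrier `-t + (α / 2) t² - B (x - z) (x - z)`, where `t` is `B (x - q) (x - q)` less its
value at `z`, is positive at `z` under the operator once `α` is large: the square contributes
`α ∑ᵢ (dt(Xᵢ))²`, and no other term involves `α`. -/
theorem exists_barrier (B : F →L[ℝ] F →L[ℝ] ℝ) (hBsymm : ∀ v w, B v w = B w v)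
    {X : ι → F → F} {b : F → F} {z q : F} (hX : ∃ i, B (z - q) (X i z) ≠ 0) :
    ∃ α > 0, 0 < secondOrderOp X b (fun x => -(B (x - q) (x - q) - B (z - q) (z - q))
      + α / 2 * (B (x - q) (x - q) - B (z - q) (z - q)) ^ 2 - B (x - z) (x - z)) z := by
  set S : ℝ := ∑ i, B (z - q) (X i z) ^ 2 with hS
  have hSpos : 0 < S := by
    obtain ⟨i, hi⟩ := hX
    exact Finset.sum_pos' (fun i _ => sq_nonneg _) ⟨i, Finset.mem_univ _, by positivity⟩
  set C : ℝ := 4 * ∑ i, B (X i z) (X i z) + 2 * B (z - q) (b z) with hC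
  refine ⟨(|C| + 1) / (4 * S), by positivity, ?_⟩
  set α : ℝ := (|C| + 1) / (4 * S) with hα
  have hαS : α * (4 * S) = |C| + 1 := by rw [hα]; field_simp
  have hq : ∀ a x : F, HasFDerivAt (fun x => B (x - a) (x - a)) ((2 : ℝ) • B (x - a)) x := by
    intro a x
    have h1 : HasFDerivAt (fun x : F => x - a) (ContinuousLinearMap.id ℝ F) x :=
      (hasFDerivAt_id x).sub_const a
    have h2 := (B.hasFDerivAt.comp x h1).clm_apply h1
    refine h2.congr_fderiv ?_
    ext v
    simp [hBsymm v]
    ring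
  set t : F → ℝ := fun x => B (x - q) (x - q) - B (z - q) (z - q) with ht
  have htd : ∀ x, HasFDerivAt t ((2 : ℝ) • B (x - q)) x := fun x => (hq q x).sub_const _
  have hd : fderiv ℝ (fun x => -t x + α / 2 * t x ^ 2 - B (x - z) (x - z))
      = fun x => (-1 + α * t x) • ((2 : ℝ) • B (x - q)) - (2 : ℝ) • B (x - z) := by
    funext x
    have h1 := (((htd x).neg.add (((htd x).pow 2).const_mul (α / 2))).sub (hq z x)).fderiv
    refine h1.trans ?_
    ext v
    simp
    ring
  have hdd : HasFDerivAt
      (fun x => (-1 + α * t x) • ((2 : ℝ) • B (x - q)) - (2 : ℝ) • B (x - z))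
      ((-1 + α * t z) • ((2 : ℝ) • B) + (α • ((2 : ℝ) • B (z - q))).smulRight
        ((2 : ℝ) • B (z - q)) - (2 : ℝ) • B) z := by
    have h1 : ∀ a, HasFDerivAt (fun x : F => (2 : ℝ) • B (x - a)) ((2 : ℝ) • B) z := fun a => by
      have : HasFDerivAt (fun x : F => x - a) (ContinuousLinearMap.id ℝ F) z :=
        (hasFDerivAt_id z).sub_const a
      exact (B.hasFDerivAt.comp z this).const_smul (2 : ℝ)
    exact ((((htd z).const_mul α).const_add (-1)).smul (h1 q)).sub (h1 z)
  have htz : t z = 0 := by simp [ht]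
  have hval : secondOrderOp X b (fun x => -t x + α / 2 * t x ^ 2 - B (x - z) (x - z)) z
      = α * (4 * S) - C := by
    rw [secondOrderOp, hd, hdd.fderiv, htz, hS, hC]
    simp only [ContinuousLinearMap.smulRight_apply, add_apply, sub_apply, smul_apply, smul_eq_mul,
      sub_self, map_zero, zero_apply, Finset.mul_sum, mul_zero, add_zero]
    rw [← sub_sub, ← Finset.sum_sub_distrib, sub_eq_add_neg (Finset.sum _ _)]
    congr 1
    · exact Finset.sum_congr rfl fun i _ => by ring
    · ring
  rw [hval, hαS]
  linarith [le_abs_self C]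

variable [FiniteDimensional ℝ F]

/-- A strict subsolution `ψ` that vanishes at a point `z` of the set where the subsolution `u`
attains its maximum `m` cannot be negative on the rest of that set near `z`: otherwise a small
multiple of `ψ` could be added to `u` so as to create an interior maximum at which the operator is
positive. -/
theorem not_touching_maximum_set {T : Set F} (hT : IsOpen T) {u : F → ℝ}
    (hu : ContDiffOn ℝ 2 u T) {X : ι → F → F} (hX : ∀ i, ContinuousOn (X i) T) {b : F → F}
    (hb : ContinuousOn b T) (hL : ∀ y ∈ T, 0 ≤ secondOrderOp X b u y) {m : ℝ}
    (hm : ∀ y ∈ T, u y ≤ m) {z : F} (hz : z ∈ T) (huz : u z = m) {ψ : F → ℝ}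
    (hψ : ContDiff ℝ 2 ψ) (hψz : ψ z = 0) (hLψ : 0 < secondOrderOp X b ψ z)
    (htouch : ∀ᶠ x in 𝓝 z, u x = m → x ≠ z → ψ x < 0) : False := by
  have hTz : T ∈ 𝓝 z := hT.mem_nhds hz
  have hev : ∀ᶠ x in 𝓝 z, x ∈ T ∧ 0 < secondOrderOp X b ψ x ∧ (u x = m → x ≠ z → ψ x < 0) := by
    have hc : ContinuousAt (secondOrderOp X b ψ) z := continuousAt_secondOrderOp
      (fun i => (hX i).continuousAt hTz) (hb.continuousAt hTz) hψ
    filter_upwards [hTz, hc.eventually (lt_mem_nhds hLψ), htouch] with x h1 h2 h3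
      using ⟨h1, h2, h3⟩
  obtain ⟨r, hr, hball⟩ := Metric.nhds_basis_closedBall.eventually_iff.1 hev
  have huC : ContinuousOn u (Metric.closedBall z r) :=
    hu.continuousOn.mono fun x hx => (hball hx).1
  have hsub : Metric.sphere z r ⊆ Metric.closedBall z r := Metric.sphere_subset_closedBall
  -- where `ψ ≥ 0` on the sphere, `u` stays below `m` by a fixed amount
  obtain ⟨δ, hδ, hδu⟩ : ∃ δ > 0, ∀ x ∈ Metric.sphere z r, 0 ≤ ψ x → u x ≤ m - δ := by
    have hK : IsCompact (Metric.sphere z r ∩ {x | 0 ≤ ψ x}) :=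
      (isCompact_sphere z r).inter_right (isClosed_le continuous_const hψ.continuous)
    rcases (Metric.sphere z r ∩ {x | 0 ≤ ψ x}).eq_empty_or_nonempty with he | hne
    · refine ⟨1, one_pos, fun x hx h0 => ?_⟩
      exact absurd (show x ∈ Metric.sphere z r ∩ {x | 0 ≤ ψ x} from ⟨hx, h0⟩) (by simp [he])
    · obtain ⟨p, hp, hpmax⟩ := hK.exists_isMaxOn hne (huC.mono fun x hx => hsub hx.1)
      refine ⟨m - u p, ?_, fun x hx h0 => ?_⟩
      · have hpz : p ≠ z := by
          rintro rfl
          have := hp.1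
          simp at this
          exact hr.ne this
        have hpb := hball (hsub hp.1)
        have hp0 : 0 ≤ ψ p := hp.2
        rcases (hm p hpb.1).lt_or_eq with h | h
        · linarith
        · exact absurd (hpb.2.2 h hpz) (not_lt.2 hp0)
      · have := hpmax (show x ∈ Metric.sphere z r ∩ {x | 0 ≤ ψ x} from ⟨hx, h0⟩)
        simp only [Set.mem_ofPred_eq] at this
        linarith
  obtain ⟨C, hC⟩ := (isCompact_sphere z r).exists_bound_of_continuousOn hψ.continuous.continuousOn
  -- with this `ε` the perturbation `ε ψ` is at most `δ / 2` on the sphere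
  set ε : ℝ := δ / (2 * (|C| + 1)) with hε
  have hCpos : 0 < |C| + 1 := by positivity
  have hεpos : 0 < ε := by positivity
  have hεC : ε * (|C| + 1) = δ / 2 := by rw [hε]; field_simp
  set w : F → ℝ := fun x => u x + ε * ψ x with hw
  have hbd : ∀ x ∈ Metric.sphere z r, w x < m := by
    intro x hx
    rcases le_or_gt 0 (ψ x) with h0 | h0
    · have h1 := hδu x hx h0
      have h2 : ψ x ≤ |C| + 1 := by
        have := (Real.le_norm_self _).trans (hC x hx)
        linarith [le_abs_self C]
      have h3 := mul_le_mul_of_nonneg_left h2 hεpos.le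
      simp only [hw]; linarith
    · have h1 := hm x (hball (hsub hx)).1
      have h2 := mul_neg_of_pos_of_neg hεpos h0
      simp only [hw]; linarith
  obtain ⟨y, hy, hymax⟩ := (isCompact_closedBall z r).exists_isMaxOn
    ⟨z, Metric.mem_closedBall_self hr.le⟩
    (huC.add (continuousOn_const.mul hψ.continuous.continuousOn) : ContinuousOn w _)
  have hwy : m ≤ w y := by
    have := hymax (Metric.mem_closedBall_self hr.le)
    simpa [hw, huz, hψz] using this
  have hyball : y ∈ Metric.ball z r := by
    rw [Metric.mem_ball]
    refine lt_of_le_of_ne hy fun h => ?_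
    exact absurd (hbd y h) (not_lt.2 hwy)
  have hloc : IsLocalMax w y := hymax.isLocalMax
    (Filter.mem_of_superset (Metric.isOpen_ball.mem_nhds hyball) Metric.ball_subset_closedBall)
  have hyT := (hball hy).1
  have huy : ContDiffAt ℝ 2 u y := hu.contDiffAt (hT.mem_nhds hyT)
  have h1 : secondOrderOp X b w y ≤ 0 := secondOrderOp_nonpos_of_isLocalMax
    (huy.add (contDiffAt_const.mul hψ.contDiffAt)) hloc
  rw [hw, secondOrderOp_add_const_mul huy hψ.contDiffAt] at h1
  have h2 := mul_pos hεpos (hball hy).2.1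
  linarith [hL y hyT]

/-- Hopf's strong maximum principle: the set where a subsolution of a second-order elliptic
equation without zeroth-order term attains its maximum is open. -/
theorem isOpen_maximum_set {T : Set F} (hT : IsOpen T) {u : F → ℝ}
    (hu : ContDiffOn ℝ 2 u T) {X : ι → F → F} (hX : ∀ i, ContinuousOn (X i) T) {b : F → F}
    (hb : ContinuousOn b T)
    (hell : ∀ y ∈ T, ∀ ℓ : F →L[ℝ] ℝ, (∀ i, ℓ (X i y) = 0) → ℓ = 0)
    (hL : ∀ y ∈ T, 0 ≤ secondOrderOp X b u y) {m : ℝ} (hm : ∀ y ∈ T, u y ≤ m) :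
    IsOpen {y | y ∈ T ∧ u y = m} := by
  rw [isOpen_iff_mem_nhds]
  rintro y ⟨hyT, hym⟩
  set L := toEuclidean (E := F)
  set K : ℝ := ‖(L.symm : EuclideanSpace ℝ (Fin (Module.finrank ℝ F)) →L[ℝ] F)‖
  have hKL' : ∀ x : F, ‖x‖ ≤ K * ‖L x‖ := fun x => by
    simpa using ContinuousLinearMap.le_opNorm
      (L.symm : EuclideanSpace ℝ (Fin (Module.finrank ℝ F)) →L[ℝ] F) (L x)
  obtain ⟨r, hr, hrT⟩ := Metric.nhds_basis_closedBall.mem_iff.1 (hT.mem_nhds hyT)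
  have hnear : ∀ᶠ q in 𝓝 y, K * (2 * ‖L (y - q)‖) < r := by
    have hc : Continuous fun q : F => K * (2 * ‖L (y - q)‖) := by fun_prop
    exact hc.continuousAt.eventually (gt_mem_nhds (by simpa using hr))
  filter_upwards [hnear] with q hq
  by_contra hqZ
  have hKc : IsCompact (Metric.closedBall y r ∩ u ⁻¹' {m}) :=
    (isCompact_closedBall y r).of_isClosed_subset
      ((hu.continuousOn.mono hrT).preimage_isClosed_of_isClosed Metric.isClosed_closedBall
        isClosed_singleton) Set.inter_subset_left
  -- `z` is a point of the maximum set nearest to `q`, in a Euclidean norm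
  obtain ⟨z, ⟨hzb, hzm⟩, hzmin⟩ := hKc.exists_isMinOn (f := fun x => ‖L (x - q)‖)
    ⟨y, Metric.mem_closedBall_self hr.le, hym⟩ (by fun_prop)
  have hzT : z ∈ T := hrT hzb
  have hzq : z ≠ q := by
    rintro rfl
    exact hqZ ⟨hzT, hzm⟩
  have hzball : z ∈ Metric.ball y r := by
    have h1 : ‖L (z - q)‖ ≤ ‖L (y - q)‖ :=
      hzmin (show y ∈ _ from ⟨Metric.mem_closedBall_self hr.le, hym⟩)
    have h2 : ‖L (z - y)‖ ≤ ‖L (z - q)‖ + ‖L (y - q)‖ := by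
      have : L (z - y) = L (z - q) - L (y - q) := by rw [← map_sub]; congr 1; abel
      rw [this]; exact norm_sub_le _ _
    rw [Metric.mem_ball, dist_eq_norm]
    calc ‖z - y‖ ≤ K * ‖L (z - y)‖ := hKL' _
      _ ≤ K * (2 * ‖L (y - q)‖) := by gcongr; linarith
      _ < r := hq
  let B : F →L[ℝ] F →L[ℝ] ℝ :=
    (isBoundedBilinearMap_inner (𝕜 := ℝ)
      (E := EuclideanSpace ℝ (Fin (Module.finrank ℝ F)))).toContinuousLinearMap.bilinearComp
        (L : F →L[ℝ] EuclideanSpace ℝ (Fin (Module.finrank ℝ F)))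
        (L : F →L[ℝ] EuclideanSpace ℝ (Fin (Module.finrank ℝ F)))
  have hB : ∀ v w, B v w = inner ℝ (L v) (L w) := fun v w => rfl
  have hBself : ∀ v, B v v = ‖L v‖ ^ 2 := fun v => by rw [hB, real_inner_self_eq_norm_sq]
  have hBne : ∃ i, B (z - q) (X i z) ≠ 0 := by
    by_contra! h
    have h1 := hell z hzT (B (z - q)) h
    have h2 := hBself (z - q)
    rw [h1] at h2
    have h3 : L (z - q) = 0 := by simpa using h2.symm
    exact hzq (sub_eq_zero.1 ((map_eq_zero_iff L L.injective).1 h3))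
  obtain ⟨α, hα, hαL⟩ := exists_barrier B (fun v w => by rw [hB, hB, real_inner_comm]) hBne (b := b)
  refine not_touching_maximum_set hT hu hX hb hL hm hzT hzm ?_ ?_ hαL ?_
  · fun_prop
  · simp
  · have hsmall : ∀ᶠ x in 𝓝 z, α * (B (x - q) (x - q) - B (z - q) (z - q)) < 2 := by
      have hc : Continuous fun x => α * (B (x - q) (x - q) - B (z - q) (z - q)) := by fun_prop
      exact hc.continuousAt.eventually (gt_mem_nhds (by simp))
    filter_upwards [hsmall, Metric.isOpen_ball.mem_nhds hzball] with x hx hxb hxm hxz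
    have ht : 0 ≤ B (x - q) (x - q) - B (z - q) (z - q) := by
      have h1 : ‖L (z - q)‖ ≤ ‖L (x - q)‖ :=
        hzmin (show x ∈ _ from ⟨Metric.ball_subset_closedBall hxb, hxm⟩)
      rw [hBself, hBself, sub_nonneg]
      gcongr
    have hpos : 0 < B (x - z) (x - z) := by
      rw [hBself]
      have : L (x - z) ≠ 0 := (map_ne_zero_iff L L.injective).2 (sub_ne_zero.2 hxz)
      positivity
    -- with `t ≥ 0` and `α t < 2` the first two terms sum to `-t (1 - α t / 2) ≤ 0`
    nlinarith [mul_le_mul_of_nonneg_left hx.le ht]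

end MaximumPrinciple

/-! ### Forms and endomorphism fields in charts -/

section Charts

variable {E : Type*} [NormedAddCommGroup E] [NormedSpace ℝ E]
  {M : Type*} [TopologicalSpace M] [ChartedSpace E M]

theorem inChart_sub {k : ℕ} (α β : DForm E M k) (x₀ : M) :
    inChart (α - β) x₀ = inChart α x₀ - inChart β x₀ := by
  funext y; ext v; rfl

theorem inChart_neg {k : ℕ} (α : DForm E M k) (x₀ : M) : inChart (-α) x₀ = -inChart α x₀ := by
  funext y; ext v; rfl

theorem extD_neg {k : ℕ} (α : DForm E M k) : extD (-α) = -extD α := by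
  funext x
  have h : extDeriv (inChart (-α) x) (extChartAt 𝓘(ℝ, E) x x)
      = -extDeriv (inChart α x) (extChartAt 𝓘(ℝ, E) x x) := by
    rw [inChart_neg, ← neg_one_smul ℝ (inChart α x), extDeriv_smul, neg_one_smul]
  ext v
  simp only [extD, h]
  rfl

theorem extD_sub {k : ℕ} (α β : DForm E M k) (x : M)
    (hα : DifferentiableAt ℝ (inChart α x) (extChartAt 𝓘(ℝ, E) x x))
    (hβ : DifferentiableAt ℝ (inChart β x) (extChartAt 𝓘(ℝ, E) x x)) :
    extD (α - β) x = extD α x - extD β x := by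
  have h : extDeriv (inChart (α - β) x) (extChartAt 𝓘(ℝ, E) x x)
      = extDeriv (inChart α x) (extChartAt 𝓘(ℝ, E) x x)
        - extDeriv (inChart β x) (extChartAt 𝓘(ℝ, E) x x) := by
    rw [inChart_sub, sub_eq_add_neg, ← neg_one_smul ℝ (inChart β x),
      extDeriv_add hα (hβ.const_smul _), extDeriv_smul, neg_one_smul, sub_eq_add_neg]
  ext v
  simp only [extD, h]
  rfl

variable [IsManifold 𝓘(ℝ, E) ∞ M]

theorem mfderiv_extChartAt_comp_mfderiv_symm {x₀ : M} {y : E}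
    (hy : y ∈ (extChartAt 𝓘(ℝ, E) x₀).target) (X : E) :
    mfderiv 𝓘(ℝ, E) 𝓘(ℝ, E) (extChartAt 𝓘(ℝ, E) x₀) ((extChartAt 𝓘(ℝ, E) x₀).symm y)
      (mfderiv 𝓘(ℝ, E) 𝓘(ℝ, E) (extChartAt 𝓘(ℝ, E) x₀).symm y X) = X := by
  have : IsManifold 𝓘(ℝ, E) 1 M := IsManifold.of_le (n := ∞) (by simp)
  have h := mfderiv_extChartAt_comp_mfderivWithin_extChartAt_symm (I := 𝓘(ℝ, E)) hy
  simp only [modelWithCornersSelf_coe, Set.range_id, mfderivWithin_univ] at h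
  exact congrArg (fun f : E →L[ℝ] E => f X) h

theorem mfderiv_symm_comp_mfderiv_extChartAt {x₀ : M} {y : E}
    (hy : y ∈ (extChartAt 𝓘(ℝ, E) x₀).target)
    (v : TangentSpace 𝓘(ℝ, E) ((extChartAt 𝓘(ℝ, E) x₀).symm y)) :
    mfderiv 𝓘(ℝ, E) 𝓘(ℝ, E) (extChartAt 𝓘(ℝ, E) x₀).symm y
      (mfderiv 𝓘(ℝ, E) 𝓘(ℝ, E) (extChartAt 𝓘(ℝ, E) x₀) ((extChartAt 𝓘(ℝ, E) x₀).symm y) v)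
      = v := by
  have : IsManifold 𝓘(ℝ, E) 1 M := IsManifold.of_le (n := ∞) (by simp)
  have h := mfderivWithin_extChartAt_symm_comp_mfderiv_extChartAt (I := 𝓘(ℝ, E)) hy
  simp only [modelWithCornersSelf_coe, Set.range_id, mfderivWithin_univ] at h
  exact congrArg (fun f : TangentSpace 𝓘(ℝ, E) ((extChartAt 𝓘(ℝ, E) x₀).symm y) →L[ℝ]
    TangentSpace 𝓘(ℝ, E) ((extChartAt 𝓘(ℝ, E) x₀).symm y) => f v) h

theorem mdifferentiableAt_extChartAt_symm {x₀ : M} {y : E}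
    (hy : y ∈ (extChartAt 𝓘(ℝ, E) x₀).target) :
    MDifferentiableAt 𝓘(ℝ, E) 𝓘(ℝ, E) (extChartAt 𝓘(ℝ, E) x₀).symm y := by
  have : IsManifold 𝓘(ℝ, E) 1 M := IsManifold.of_le (n := ∞) (by simp)
  have h := mdifferentiableWithinAt_extChartAt_symm (I := 𝓘(ℝ, E)) hy
  simpa [mdifferentiableWithinAt_univ] using h

/-- The exterior derivative does not depend on the chart in which it is computed. -/
theorem extD_apply_of_mem_source {k : ℕ} (α : DForm E M k) {x₀ z : M}
    (hz : z ∈ (extChartAt 𝓘(ℝ, E) x₀).source)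
    (hα : DifferentiableAt ℝ (inChart α x₀) (extChartAt 𝓘(ℝ, E) x₀ z)) :
    extD α z = (extDeriv (inChart α x₀) (extChartAt 𝓘(ℝ, E) x₀ z)).compContinuousLinearMap
      (mfderiv 𝓘(ℝ, E) 𝓘(ℝ, E) (extChartAt 𝓘(ℝ, E) x₀) z) := by
  have : IsManifold 𝓘(ℝ, E) 1 M := IsManifold.of_le (n := ∞) (by simp)
  set e := extChartAt 𝓘(ℝ, E) x₀ with he
  set e' := extChartAt 𝓘(ℝ, E) z with he'
  set τ : E → E := e ∘ e'.symm with hτ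
  have hzz : z ∈ e'.source := mem_extChartAt_source z
  have hτz : τ (e' z) = e z := by simp [hτ, e'.left_inv hzz]
  have hnear : ∀ᶠ y in 𝓝 (e' z), y ∈ e'.target ∧ e'.symm y ∈ e.source := by
    have h1 : ∀ᶠ y in 𝓝 (e' z), y ∈ e'.target := extChartAt_target_mem_nhds z
    have h2 : ContinuousAt e'.symm (e' z) := continuousAt_extChartAt_symm z
    have h3 : e.source ∈ 𝓝 (e'.symm (e' z)) := by
      rw [e'.left_inv hzz]
      exact (isOpen_extChartAt_source x₀).mem_nhds hz
    exact h1.and (h2.eventually h3)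
  have hpull : ∀ᶠ y in 𝓝 (e' z), inChart α z y
      = (inChart α x₀ (τ y)).compContinuousLinearMap (fderiv ℝ τ y) := by
    filter_upwards [hnear, hnear.eventually_nhds] with y hy hyn
    have hτy : τ y ∈ e.target := e.map_source hy.2
    have hinv : e.symm (τ y) = e'.symm y := e.left_inv hy.2
    have hτd : MDifferentiableAt 𝓘(ℝ, E) 𝓘(ℝ, E) τ y :=
      MDifferentiableAt.comp y (mdifferentiableAt_extChartAt (by
        rw [← extChartAt_source 𝓘(ℝ, E)]; exact hy.2)) (mdifferentiableAt_extChartAt_symm hy.1)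
    have hchain : mfderiv 𝓘(ℝ, E) 𝓘(ℝ, E) (e.symm ∘ τ) y
        = (mfderiv 𝓘(ℝ, E) 𝓘(ℝ, E) e.symm (τ y)).comp (mfderiv 𝓘(ℝ, E) 𝓘(ℝ, E) τ y) :=
      mfderiv_comp y (mdifferentiableAt_extChartAt_symm hτy) hτd
    have heq : (e.symm ∘ τ) =ᶠ[𝓝 y] e'.symm := by
      filter_upwards [hyn] with y' hy' using e.left_inv hy'.2
    rw [heq.mfderiv_eq, mfderiv_eq_fderiv] at hchain
    -- the two base points agree only propositionally, so they are first made variables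
    have key : ∀ (p q : M) (hpq : p = q) (L L' : E →L[ℝ] E), L = L' →
        ((α p).compContinuousLinearMap L : E [⋀^Fin k]→L[ℝ] ℝ)
          = (α q).compContinuousLinearMap L' := by
      rintro p _ rfl L _ rfl; rfl
    exact key _ _ hinv.symm _ _ hchain
  have hτc : ContDiffAt ℝ ∞ τ (e' z) := by
    have := contDiffWithinAt_ext_coord_change (I := 𝓘(ℝ, E)) (n := ∞) x₀ z (y := e' z) (by
      rw [PartialEquiv.trans_source, PartialEquiv.symm_source]
      exact ⟨e'.map_source hzz, show e'.symm (e' z) ∈ e.source by rwa [e'.left_inv hzz]⟩)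
    rwa [modelWithCornersSelf_coe, Set.range_id, contDiffWithinAt_univ] at this
  have hext : extDeriv (inChart α z) (e' z)
      = (extDeriv (inChart α x₀) (e z)).compContinuousLinearMap (fderiv ℝ τ (e' z)) := by
    rw [Filter.EventuallyEq.extDeriv_eq hpull,
      extDeriv_pullback (r := ∞) (by rwa [hτz]) hτc
        (by
          rw [minSmoothness_of_isRCLikeNormedField]
          exact WithTop.coe_le_coe.2 (le_top : (2 : ℕ∞) ≤ ⊤)), hτz]
  have hchain : mfderiv 𝓘(ℝ, E) 𝓘(ℝ, E) e z
      = (fderiv ℝ τ (e' z)).comp (mfderiv 𝓘(ℝ, E) 𝓘(ℝ, E) e' z) := by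
    have h1 : mfderiv 𝓘(ℝ, E) 𝓘(ℝ, E) (τ ∘ e') z
        = (mfderiv 𝓘(ℝ, E) 𝓘(ℝ, E) τ (e' z)).comp (mfderiv 𝓘(ℝ, E) 𝓘(ℝ, E) e' z) :=
      mfderiv_comp z (hτc.differentiableAt (by simp)).mdifferentiableAt
        (mdifferentiableAt_extChartAt (mem_chart_source E z))
    have h2 : (τ ∘ e') =ᶠ[𝓝 z] e := by
      filter_upwards [extChartAt_source_mem_nhds (I := 𝓘(ℝ, E)) z] with p hp
      simp [hτ, e'.left_inv hp]
    rw [h2.mfderiv_eq, mfderiv_eq_fderiv] at h1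
    exact h1
  rw [hchain, extD, ← he', hext]
  rfl

/-- The endomorphism field `S` in the chart around `x₀`: its conjugate by the differential of
the chart. -/
noncomputable def chartEnd (S : EndField E M) (x₀ : M) (y : E) : E →L[ℝ] E :=
  ((mfderiv 𝓘(ℝ, E) 𝓘(ℝ, E) (extChartAt 𝓘(ℝ, E) x₀) ((extChartAt 𝓘(ℝ, E) x₀).symm y)).comp
    (S ((extChartAt 𝓘(ℝ, E) x₀).symm y))).comp
      (mfderiv 𝓘(ℝ, E) 𝓘(ℝ, E) (extChartAt 𝓘(ℝ, E) x₀).symm y)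

theorem mfderiv_symm_chartEnd (S : EndField E M) {x₀ : M} {y : E}
    (hy : y ∈ (extChartAt 𝓘(ℝ, E) x₀).target) (X : E) :
    mfderiv 𝓘(ℝ, E) 𝓘(ℝ, E) (extChartAt 𝓘(ℝ, E) x₀).symm y (chartEnd S x₀ y X)
      = S ((extChartAt 𝓘(ℝ, E) x₀).symm y)
        (mfderiv 𝓘(ℝ, E) 𝓘(ℝ, E) (extChartAt 𝓘(ℝ, E) x₀).symm y X) :=
  mfderiv_symm_comp_mfderiv_extChartAt hy _

theorem chartEnd_chartEnd (S T : EndField E M) {x₀ : M} {y : E}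
    (hy : y ∈ (extChartAt 𝓘(ℝ, E) x₀).target) (X : E) :
    chartEnd S x₀ y (chartEnd T x₀ y X) = chartEnd (fun x => (S x).comp (T x)) x₀ y X := by
  change mfderiv 𝓘(ℝ, E) 𝓘(ℝ, E) (extChartAt 𝓘(ℝ, E) x₀) _
    (S _ (mfderiv 𝓘(ℝ, E) 𝓘(ℝ, E) (extChartAt 𝓘(ℝ, E) x₀).symm y (chartEnd T x₀ y X))) = _
  rw [mfderiv_symm_chartEnd T hy]
  rfl

/-- A smooth endomorphism field is smooth in the chart around `x₀`, at the centre of the chart. -/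
theorem contDiffAt_chartEnd {S : EndField E M} (hS : IsSmoothEndField S) (x₀ : M) :
    ContDiffAt ℝ ∞ (chartEnd S x₀) (extChartAt 𝓘(ℝ, E) x₀ x₀) := by
  have : IsManifold 𝓘(ℝ, E) 1 M := IsManifold.of_le (n := ∞) (by simp)
  have h1 := ((contMDiffAt_hom_bundle _).1 (hS x₀)).2
  set e := extChartAt 𝓘(ℝ, E) x₀ with he
  have h2 : ContMDiffAt 𝓘(ℝ, E) 𝓘(ℝ, E) ∞ e.symm (e x₀) :=
    (contMDiffOn_extChartAt_symm x₀).contMDiffAt (extChartAt_target_mem_nhds x₀)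
  have h3 : e.symm (e x₀) = x₀ := e.left_inv (mem_extChartAt_source x₀)
  rw [← h3] at h1
  have h4 := h1.comp (e x₀) h2
  rw [contMDiffAt_iff_contDiffAt] at h4
  refine h4.congr_of_eventuallyEq ?_
  filter_upwards [extChartAt_target_mem_nhds (I := 𝓘(ℝ, E)) x₀] with y hy
  have hys : e.symm y ∈ (chartAt E x₀).source := by
    rw [← extChartAt_source 𝓘(ℝ, E)]; exact e.map_target hy
  simp only [Function.comp_apply, h3]
  rw [ContinuousLinearMap.inCoordinates, TangentBundle.continuousLinearMapAt_trivializationAt hys,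
    TangentBundle.symmL_trivializationAt hys]
  simp only [modelWithCornersSelf_coe, Set.range_id, mfderivWithin_univ]
  rw [← he, e.right_inv hy]
  rfl

end Charts

/-! ### The operator `d d_I` in a chart -/

section TwistedHessian

variable {E : Type*} [NormedAddCommGroup E] [NormedSpace ℝ E]
  {M : Type*} [TopologicalSpace M] [ChartedSpace E M]

theorem extD_ofFun_apply [IsManifold 𝓘(ℝ, E) ∞ M] {f : M → ℝ} {x : M}
    (hf : MDifferentiableAt 𝓘(ℝ, E) 𝓘(ℝ) f x) (v : Fin 1 → TangentSpace 𝓘(ℝ, E) x) :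
    extD (ofFun f : DForm E M 0) x v = mfderiv 𝓘(ℝ, E) 𝓘(ℝ) f x (v 0) := by
  have h1 : inChart (ofFun f : DForm E M 0) x = fun y =>
      ContinuousAlternatingMap.constOfIsEmpty ℝ E (Fin 0)
        (f ((extChartAt 𝓘(ℝ, E) x).symm y)) := by
    funext y; ext v; rfl
  have h2 : mfderiv 𝓘(ℝ, E) 𝓘(ℝ) f x
      = fderiv ℝ (fun y => f ((extChartAt 𝓘(ℝ, E) x).symm y)) (extChartAt 𝓘(ℝ, E) x x) := by
    rw [hf.mfderiv]
    simp only [writtenInExtChartAt, modelWithCornersSelf_coe, Set.range_id, fderivWithin_univ]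
    rfl
  have : IsManifold 𝓘(ℝ, E) 1 M := IsManifold.of_le (n := ∞) (by simp)
  have h3 := mfderiv_extChartAt_self (I := 𝓘(ℝ, E)) (x := x)
  rw [extD, h1, extDeriv_constOfIsEmpty, h3, h2]
  rfl

variable [IsManifold 𝓘(ℝ, E) ∞ M]

theorem twistedD_ofFun_apply (S : EndField E M) {f : M → ℝ} {x : M}
    (hf : MDifferentiableAt 𝓘(ℝ, E) 𝓘(ℝ) f x) (v : Fin 1 → TangentSpace 𝓘(ℝ, E) x) :
    twistedD S (ofFun f) x v = -mfderiv 𝓘(ℝ, E) 𝓘(ℝ) f x (S x (v 0)) := by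
  have h0 : actForm S (ofFun f : DForm E M 0) = ofFun f := by
    funext x; ext v; simp [actForm, act, ofFun]
  have h1 := extD_ofFun_apply hf (S x ∘ v)
  rw [twistedD, h0]
  simp only [pow_zero, one_smul, actForm, act, ContinuousAlternatingMap.smul_apply,
    ContinuousAlternatingMap.compContinuousLinearMap_apply, smul_eq_mul]
  rw [h1, zero_add, pow_one]
  exact neg_one_mul (_ : ℝ)

theorem contDiffOn_comp_extChartAt_symm {f : M → ℝ} (hf : ContMDiff 𝓘(ℝ, E) 𝓘(ℝ) ∞ f) (x₀ : M) :
    ContDiffOn ℝ ∞ (f ∘ (extChartAt 𝓘(ℝ, E) x₀).symm) (extChartAt 𝓘(ℝ, E) x₀).target :=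
  contMDiffOn_iff_contDiffOn.1 (hf.comp_contMDiffOn (contMDiffOn_extChartAt_symm x₀))

/-- In a chart `d_S f` is the one-form `-du ∘ S`, where `u` is the function `f` in the chart. -/
theorem inChart_twistedD_ofFun (S : EndField E M) {f : M → ℝ}
    (hf : ContMDiff 𝓘(ℝ, E) 𝓘(ℝ) ∞ f) {x₀ : M} {y : E}
    (hy : y ∈ (extChartAt 𝓘(ℝ, E) x₀).target) :
    inChart (twistedD S (ofFun f)) x₀ y =
      ContinuousAlternatingMap.ofSubsingletonLIE (𝕜 := ℝ) (E := E) (F := ℝ) (0 : Fin 1)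
      (-(fderiv ℝ (f ∘ (extChartAt 𝓘(ℝ, E) x₀).symm) y).comp (chartEnd S x₀ y)) := by
  ext v
  have hfd : ∀ x, MDifferentiableAt 𝓘(ℝ, E) 𝓘(ℝ) f x := fun x => hf.mdifferentiableAt (by simp)
  have h1 : mfderiv 𝓘(ℝ, E) 𝓘(ℝ) (f ∘ (extChartAt 𝓘(ℝ, E) x₀).symm) y
      = (mfderiv 𝓘(ℝ, E) 𝓘(ℝ) f ((extChartAt 𝓘(ℝ, E) x₀).symm y)).comp
        (mfderiv 𝓘(ℝ, E) 𝓘(ℝ, E) (extChartAt 𝓘(ℝ, E) x₀).symm y) :=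
    mfderiv_comp y (hfd _) (mdifferentiableAt_extChartAt_symm hy)
  rw [mfderiv_eq_fderiv] at h1
  have h2 := twistedD_ofFun_apply S (hfd ((extChartAt 𝓘(ℝ, E) x₀).symm y))
    (mfderiv 𝓘(ℝ, E) 𝓘(ℝ, E) (extChartAt 𝓘(ℝ, E) x₀).symm y ∘ v)
  refine h2.trans ?_
  rw [h1]
  change _ = -(mfderiv 𝓘(ℝ, E) 𝓘(ℝ) f ((extChartAt 𝓘(ℝ, E) x₀).symm y)
    (mfderiv 𝓘(ℝ, E) 𝓘(ℝ, E) (extChartAt 𝓘(ℝ, E) x₀).symm y (chartEnd S x₀ y (v 0))))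
  rw [mfderiv_symm_chartEnd S hy]
  rfl

/-- The expression for `d d_S f` in a chart: the second derivatives of `u` come with `S`, the first
derivatives with the derivative of `S`. -/
theorem extDeriv_inChart_twistedD (S : EndField E M) {f : M → ℝ}
    (hf : ContMDiff 𝓘(ℝ, E) 𝓘(ℝ) ∞ f) {x₀ : M} {y : E}
    (hy : y ∈ (extChartAt 𝓘(ℝ, E) x₀).target) (hS : DifferentiableAt ℝ (chartEnd S x₀) y) :
    DifferentiableAt ℝ (inChart (twistedD S (ofFun f)) x₀) y ∧
    ∀ v w : E, extDeriv (inChart (twistedD S (ofFun f)) x₀) y ![v, w]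
      = fderiv ℝ (fderiv ℝ (f ∘ (extChartAt 𝓘(ℝ, E) x₀).symm)) y w (chartEnd S x₀ y v)
        + fderiv ℝ (f ∘ (extChartAt 𝓘(ℝ, E) x₀).symm) y (fderiv ℝ (chartEnd S x₀) y w v)
        - fderiv ℝ (fderiv ℝ (f ∘ (extChartAt 𝓘(ℝ, E) x₀).symm)) y v (chartEnd S x₀ y w)
        - fderiv ℝ (f ∘ (extChartAt 𝓘(ℝ, E) x₀).symm) y (fderiv ℝ (chartEnd S x₀) y v w) := by
  set u : E → ℝ := f ∘ (extChartAt 𝓘(ℝ, E) x₀).symm with hu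
  set A := chartEnd S x₀
  have hopen : IsOpen (extChartAt 𝓘(ℝ, E) x₀).target := isOpen_extChartAt_target x₀
  have huc : ContDiffAt ℝ ∞ u y :=
    (contDiffOn_comp_extChartAt_symm hf x₀).contDiffAt (hopen.mem_nhds hy)
  have hu2 : DifferentiableAt ℝ (fderiv ℝ u) y :=
    (huc.fderiv_right (m := 1)
      (WithTop.coe_le_coe.2 (le_top : (2 : ℕ∞) ≤ ⊤))).differentiableAt (by simp)
  have heq : inChart (twistedD S (ofFun f)) x₀ =ᶠ[𝓝 y] fun y =>
      ContinuousAlternatingMap.ofSubsingletonLIE (𝕜 := ℝ) (E := E) (F := ℝ)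
        (0 : Fin 1)
        (-(fderiv ℝ u y).comp (A y)) := by
    filter_upwards [hopen.mem_nhds hy] with y' hy' using inChart_twistedD_ofFun S hf hy'
  have hβ := (hu2.hasFDerivAt.clm_comp hS.hasFDerivAt).neg
  have hd := ((ContinuousAlternatingMap.ofSubsingletonLIE (𝕜 := ℝ) (E := E) (F := ℝ)
    (0 : Fin 1)).toContinuousLinearEquiv.hasFDerivAt.comp y hβ).congr_of_eventuallyEq heq
  refine ⟨hd.differentiableAt, fun v w => ?_⟩
  rw [extDeriv, hd.fderiv, ContinuousAlternatingMap.alternatizeUncurryFin_apply,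
    Fin.sum_univ_two]
  simp [Fin.removeNth]
  ring

end TwistedHessian

/-! ### Functions with `D D_I f = 0` -/

section Uniqueness

variable {E : Type*} [NormedAddCommGroup E] [NormedSpace ℝ E]
  {M : Type*} [TopologicalSpace M] [ChartedSpace E M] [IsManifold 𝓘(ℝ, E) ∞ M]
  (h : HypercomplexStructure E M)

namespace HypercomplexStructure

theorem DDI_apply (φ : M → ℝ) (x : M) :
    h.DDI φ x = salamonProj (h.I x) (h.J x) (h.K x) (h.ddI φ x) := rfl

variable {h}

theorem ddI_mem_salamonB {φ : M → ℝ} (hφ : h.DDI φ = 0) (x : M) :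
    h.ddI φ x ∈ salamonB (h.I x) (h.J x) (h.K x) :=
  mem_salamonB_of_salamonProj_eq_zero (h.quaternionic x) (by rw [← DDI_apply, hφ]; rfl)

theorem act_J_ddI {φ : M → ℝ} (hφ : h.DDI φ = 0) (x : M) :
    act (h.J x) (h.ddI φ x) = h.ddI φ x :=
  act_eq_of_mem_salamonB (ddI_mem_salamonB hφ x) (J_mem_sphere _ _ _)

theorem differentiableAt_chartEnd_I (h : HypercomplexStructure E M) (x : M) :
    DifferentiableAt ℝ (chartEnd h.I x) (extChartAt 𝓘(ℝ, E) x x) :=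
  (contDiffAt_chartEnd h.smooth_I x).differentiableAt (by simp)

theorem ddI_sub {φ ψ : M → ℝ} (hφ : ContMDiff 𝓘(ℝ, E) 𝓘(ℝ) ∞ φ)
    (hψ : ContMDiff 𝓘(ℝ, E) 𝓘(ℝ) ∞ ψ) : h.ddI (φ - ψ) = h.ddI φ - h.ddI ψ := by
  have h1 : twistedD h.I (ofFun (φ - ψ)) = twistedD h.I (ofFun φ) - twistedD h.I (ofFun ψ) := by
    funext x
    ext v
    have hφx : MDifferentiableAt 𝓘(ℝ, E) 𝓘(ℝ) φ x := hφ.mdifferentiableAt (by simp)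
    have hψx : MDifferentiableAt 𝓘(ℝ, E) 𝓘(ℝ) ψ x := hψ.mdifferentiableAt (by simp)
    refine (twistedD_ofFun_apply h.I (hφx.sub hψx) v).trans ?_
    rw [mfderiv_sub hφx hψx]
    refine Eq.trans ?_ (congrArg₂ (fun a b : ℝ => a - b) (twistedD_ofFun_apply h.I hφx v)
      (twistedD_ofFun_apply h.I hψx v)).symm
    exact (neg_sub_neg (_ : ℝ) _).symm ▸ neg_sub (_ : ℝ) _
  funext x
  have hx := h.differentiableAt_chartEnd_I x
  rw [ddI, h1]
  exact extD_sub _ _ x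
    (extDeriv_inChart_twistedD h.I hφ (mem_extChartAt_target x) hx).1
    (extDeriv_inChart_twistedD h.I hψ (mem_extChartAt_target x) hx).1

theorem DDI_sub {φ ψ : M → ℝ} (hφ : ContMDiff 𝓘(ℝ, E) 𝓘(ℝ) ∞ φ)
    (hψ : ContMDiff 𝓘(ℝ, E) 𝓘(ℝ) ∞ ψ) : h.DDI (φ - ψ) = h.DDI φ - h.DDI ψ := by
  funext x
  rw [DDI_apply, ddI_sub hφ hψ]
  exact salamonProj_sub _ _

theorem ddI_chart_apply {f : M → ℝ} (hf : ContMDiff 𝓘(ℝ, E) 𝓘(ℝ) ∞ f) {x₀ : M} {y : E}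
    (hy : y ∈ (extChartAt 𝓘(ℝ, E) x₀).target) (hI : DifferentiableAt ℝ (chartEnd h.I x₀) y)
    (v w : E) :
    h.ddI f ((extChartAt 𝓘(ℝ, E) x₀).symm y)
        ![mfderiv 𝓘(ℝ, E) 𝓘(ℝ, E) (extChartAt 𝓘(ℝ, E) x₀).symm y v,
          mfderiv 𝓘(ℝ, E) 𝓘(ℝ, E) (extChartAt 𝓘(ℝ, E) x₀).symm y w]
      = extDeriv (inChart (twistedD h.I (ofFun f)) x₀) y ![v, w] := by
  have hz : (extChartAt 𝓘(ℝ, E) x₀).symm y ∈ (extChartAt 𝓘(ℝ, E) x₀).source :=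
    (extChartAt 𝓘(ℝ, E) x₀).map_target hy
  have hd := (extDeriv_inChart_twistedD h.I hf hy hI).1
  rw [← (extChartAt 𝓘(ℝ, E) x₀).right_inv hy] at hd
  rw [ddI, extD_apply_of_mem_source _ hz hd, (extChartAt 𝓘(ℝ, E) x₀).right_inv hy]
  refine congrArg (extDeriv (inChart (twistedD h.I (ofFun f)) x₀) y) (funext fun i => ?_)
  fin_cases i
  · exact mfderiv_extChartAt_comp_mfderiv_symm hy v
  · exact mfderiv_extChartAt_comp_mfderiv_symm hy w

/-- The first-order part of the operator `X ↦ (d d_I f)(X, I X)` in a chart. -/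
noncomputable def torsionTerm (h : HypercomplexStructure E M) (x₀ : M) (y X : E) : E :=
  fderiv ℝ (chartEnd h.I x₀) y (chartEnd h.I x₀ y X) X
    - fderiv ℝ (chartEnd h.I x₀) y X (chartEnd h.I x₀ y X)

theorem chartEnd_I_I (h : HypercomplexStructure E M) {x₀ : M} {y : E}
    (hy : y ∈ (extChartAt 𝓘(ℝ, E) x₀).target) (X : E) :
    chartEnd h.I x₀ y (chartEnd h.I x₀ y X) = -X := by
  rw [chartEnd_chartEnd _ _ hy]
  change mfderiv 𝓘(ℝ, E) 𝓘(ℝ, E) (extChartAt 𝓘(ℝ, E) x₀) _ (h.I _ (h.I _ _)) = -X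
  rw [(h.quaternionic _).I_sq, map_neg]
  exact congrArg Neg.neg (mfderiv_extChartAt_comp_mfderiv_symm hy X)

theorem chartEnd_I_J (h : HypercomplexStructure E M) {x₀ : M} {y : E}
    (hy : y ∈ (extChartAt 𝓘(ℝ, E) x₀).target) (X : E) :
    chartEnd h.I x₀ y (chartEnd h.J x₀ y X) = -chartEnd h.J x₀ y (chartEnd h.I x₀ y X) := by
  rw [chartEnd_chartEnd _ _ hy, chartEnd_chartEnd _ _ hy]
  change mfderiv 𝓘(ℝ, E) 𝓘(ℝ, E) (extChartAt 𝓘(ℝ, E) x₀) _ (h.I _ (h.J _ _)) =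
    -mfderiv 𝓘(ℝ, E) 𝓘(ℝ, E) (extChartAt 𝓘(ℝ, E) x₀) _ (h.J _ (h.I _ _))
  rw [(h.quaternionic _).I_J, (h.quaternionic _).J_I, map_neg, neg_neg]

/-- The value `(d d_I f)(X, I X)` in a chart is the Hessian of `f` traced over `X, I X`, up to
first-order terms. -/
theorem extDeriv_twistedD_self_I {f : M → ℝ} (hf : ContMDiff 𝓘(ℝ, E) 𝓘(ℝ) ∞ f) {x₀ : M} {y : E}
    (hy : y ∈ (extChartAt 𝓘(ℝ, E) x₀).target) (hI : DifferentiableAt ℝ (chartEnd h.I x₀) y)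
    (X : E) :
    extDeriv (inChart (twistedD h.I (ofFun f)) x₀) y ![X, chartEnd h.I x₀ y X]
      = fderiv ℝ (fderiv ℝ (f ∘ (extChartAt 𝓘(ℝ, E) x₀).symm)) y X X
        + fderiv ℝ (fderiv ℝ (f ∘ (extChartAt 𝓘(ℝ, E) x₀).symm)) y (chartEnd h.I x₀ y X)
          (chartEnd h.I x₀ y X)
        + fderiv ℝ (f ∘ (extChartAt 𝓘(ℝ, E) x₀).symm) y (h.torsionTerm x₀ y X) := by
  rw [(extDeriv_inChart_twistedD h.I hf hy hI).2, h.chartEnd_I_I hy, torsionTerm, map_sub, map_neg]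
  ring

/-- If `D D_I f = 0`, then `d d_I f` is invariant under `J`, and as `I` and `J` anticommute its
values on `(X, I X)` and `(J X, I J X)` are opposite. -/
theorem extDeriv_twistedD_add_eq_zero {f : M → ℝ} (hf : ContMDiff 𝓘(ℝ, E) 𝓘(ℝ) ∞ f)
    (hf0 : h.DDI f = 0) {x₀ : M} {y : E}
    (hy : y ∈ (extChartAt 𝓘(ℝ, E) x₀).target) (hI : DifferentiableAt ℝ (chartEnd h.I x₀) y)
    (X : E) :
    extDeriv (inChart (twistedD h.I (ofFun f)) x₀) y ![X, chartEnd h.I x₀ y X]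
      + extDeriv (inChart (twistedD h.I (ofFun f)) x₀) y
        ![chartEnd h.J x₀ y X, chartEnd h.I x₀ y (chartEnd h.J x₀ y X)] = 0 := by
  have hinv : ∀ v w : E,
      extDeriv (inChart (twistedD h.I (ofFun f)) x₀) y ![chartEnd h.J x₀ y v, chartEnd h.J x₀ y w]
        = extDeriv (inChart (twistedD h.I (ofFun f)) x₀) y ![v, w] := fun v w => by
    rw [← ddI_chart_apply hf hy hI, ← ddI_chart_apply hf hy hI, mfderiv_symm_chartEnd h.J hy,
      mfderiv_symm_chartEnd h.J hy, ← act_two_apply, act_J_ddI hf0]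
  rw [h.chartEnd_I_J hy, form_neg_right, hinv]
  ring

variable [FiniteDimensional ℝ E]

/-- In a chart, a function with `D D_I f = 0` solves an elliptic equation, the sum over a basis of
the identities of `extDeriv_twistedD_add_eq_zero`; so the set where it attains its maximum is a
neighbourhood of each of its points. -/
theorem maximum_set_mem_nhds {f : M → ℝ} (hf : ContMDiff 𝓘(ℝ, E) 𝓘(ℝ) ∞ f) (hf0 : h.DDI f = 0)
    {m : ℝ} (hm : ∀ x, f x ≤ m) {x₀ : M} (hx₀ : f x₀ = m) : {x | f x = m} ∈ 𝓝 x₀ := by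
  set e := extChartAt 𝓘(ℝ, E) x₀ with he
  set A := chartEnd h.I x₀ with hA
  set B := chartEnd h.J x₀ with hB
  have hev : ∀ᶠ y in 𝓝 (e x₀), y ∈ e.target ∧ ContDiffAt ℝ 1 A y ∧ ContDiffAt ℝ 1 B y :=
    Filter.Eventually.and (extChartAt_target_mem_nhds x₀)
      ((((contDiffAt_chartEnd h.smooth_I x₀).of_le (by simp)).eventually (by simp)).and
        (((contDiffAt_chartEnd h.smooth_J x₀).of_le (by simp)).eventually (by simp)))
  obtain ⟨T, hT, hTo, hxT⟩ := eventually_nhds_iff.1 hev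
  let β := Module.finBasis ℝ E
  let κ := Fin (Module.finrank ℝ E)
  -- the second-order part is `D²u` summed over `βⱼ, I βⱼ, J βⱼ, I J βⱼ`; the constant fields `βⱼ`
  -- alone make it elliptic
  let X : ((κ ⊕ κ) ⊕ (κ ⊕ κ)) → E → E := Sum.elim
    (Sum.elim (fun j _ => β j) (fun j y => A y (β j)))
    (Sum.elim (fun j y => B y (β j)) (fun j y => A y (B y (β j))))
  let b : E → E := fun y => ∑ j, (h.torsionTerm x₀ y (β j) + h.torsionTerm x₀ y (B y (β j)))
  have hAc : ContinuousOn A T := fun y hy => (hT y hy).2.1.continuousAt.continuousWithinAt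
  have hBc : ContinuousOn B T := fun y hy => (hT y hy).2.2.continuousAt.continuousWithinAt
  have hdAc : ContinuousOn (fderiv ℝ A) T := fun y hy =>
    ((hT y hy).2.1.fderiv_right (m := 0) (by simp)).continuousAt.continuousWithinAt
  have htors : ∀ ξ : E → E, ContinuousOn ξ T → ContinuousOn (fun y => h.torsionTerm x₀ y (ξ y)) T :=
    fun ξ hξ => ((hdAc.clm_apply (hAc.clm_apply hξ)).clm_apply hξ).sub
      ((hdAc.clm_apply hξ).clm_apply (hAc.clm_apply hξ))
  have hX : ∀ i, ContinuousOn (X i) T := by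
    rintro ((j | j) | (j | j))
    · exact continuousOn_const
    · exact hAc.clm_apply continuousOn_const
    · exact hBc.clm_apply continuousOn_const
    · exact hAc.clm_apply (hBc.clm_apply continuousOn_const)
  have hb : ContinuousOn b T := continuousOn_finsetSum _ fun j _ =>
    (htors _ continuousOn_const).add (htors _ (hBc.clm_apply continuousOn_const))
  have hopen := isOpen_maximum_set hTo (u := f ∘ e.symm) (X := X) (b := b) (m := m)
    (((contDiffOn_comp_extChartAt_symm hf x₀).mono fun y hy => (hT y hy).1).of_le
      (WithTop.coe_le_coe.2 (le_top : (2 : ℕ∞) ≤ ⊤))) hX hb ?_ ?_ (fun y _ => hm _)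
  · have h1 : e ⁻¹' {y | y ∈ T ∧ (f ∘ e.symm) y = m} ∈ 𝓝 x₀ := by
      refine (continuousAt_extChartAt x₀).preimage_mem_nhds (hopen.mem_nhds ⟨hxT, ?_⟩)
      simpa [he] using hx₀
    filter_upwards [h1, extChartAt_source_mem_nhds (I := 𝓘(ℝ, E)) x₀] with x hx hxs
    have := hx.2
    rwa [Function.comp_apply, e.left_inv hxs] at this
  · intro y _ ℓ hℓ
    have : (ℓ : E →ₗ[ℝ] ℝ) = 0 := β.ext fun j => by simpa [X] using hℓ (Sum.inl (Sum.inl j))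
    ext v
    exact congrArg (fun g : E →ₗ[ℝ] ℝ => g v) this
  · intro y hy
    have hI := (hT y hy).2.1.differentiableAt (by simp)
    have hzero : ∀ j, _ := fun j => extDeriv_twistedD_add_eq_zero hf hf0 (hT y hy).1 hI (β j)
    simp only [extDeriv_twistedD_self_I hf (hT y hy).1 hI] at hzero
    refine (Eq.symm ?_).le
    rw [secondOrderOp, map_sum, Fintype.sum_sum_type, Fintype.sum_sum_type, Fintype.sum_sum_type]
    simp only [X, Sum.elim_inl, Sum.elim_inr, map_add]
    rw [← Finset.sum_add_distrib, ← Finset.sum_add_distrib, ← Finset.sum_add_distrib,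
      ← Finset.sum_add_distrib]
    refine Finset.sum_eq_zero fun j _ => ?_
    rw [← hzero j]
    ring

/-- On a compact connected manifold the maximum set is open, closed and non-empty. -/
theorem exists_eq_const_of_DDI_eq_zero [CompactSpace M] [ConnectedSpace M] {f : M → ℝ}
    (hf : ContMDiff 𝓘(ℝ, E) 𝓘(ℝ) ∞ f) (hf0 : h.DDI f = 0) : ∃ c : ℝ, ∀ x, f x = c := by
  obtain ⟨p, -, hp⟩ := isCompact_univ.exists_isMaxOn Set.univ_nonempty hf.continuous.continuousOn
  have hclopen : IsClopen {x | f x = f p} :=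
    ⟨isClosed_eq hf.continuous continuous_const, isOpen_iff_mem_nhds.2 fun x hx =>
      maximum_set_mem_nhds hf hf0 (fun x => hp (Set.mem_univ x)) hx⟩
  have huniv := hclopen.eq_univ ⟨p, rfl⟩
  exact ⟨f p, fun x => huniv.ge (Set.mem_univ x)⟩

end HypercomplexStructure

end Uniqueness

/-! ### Hyperhermitian forms -/

section Forms

variable {E : Type*} [NormedAddCommGroup E] [NormedSpace ℝ E]
  {M : Type*} [TopologicalSpace M] [ChartedSpace E M] [IsManifold 𝓘(ℝ, E) ∞ M]
  {h : HypercomplexStructure E M}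

namespace HyperhermitianMetric

theorem FI_mem_typeOneOne (g : HyperhermitianMetric h) (x : M) :
    g.FI x ∈ typeOneOne (h.I x) := by
  refine form_ext fun v w => ?_
  rw [act_two_apply]
  exact g.inv_I x _ _

/-- As `J` anticommutes with `I`, the form `F_I` is of type `(2,0) + (0,2)` with respect to `J`. -/
theorem act_J_FI (g : HyperhermitianMetric h) (x : M) : act (h.J x) (g.FI x) = -g.FI x := by
  refine form_ext fun v w => ?_
  rw [act_two_apply]
  change g.g x (h.I x (h.J x v)) (h.J x w) = -g.g x (h.I x v) w
  rw [(h.quaternionic x).I_J, ← neg_neg (h.K x v), ← (h.quaternionic x).J_I, map_neg,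
    neg_apply, g.inv_J]

end HyperhermitianMetric

/-- The difference of the two forms is `η(dθ)` and of type `(1,1)` for `I`; hence so is `dθ`, and
the `d d_I`-lemma turns it into `d d_I φ`. It is applied to `-θ` because `F - F' = Dθ`, whereas the
potential is that of `F' - F`. -/
theorem exists_potential (hdd : h.GlobalDDILemma) (g g' : HyperhermitianMetric h)
    (hclass : h.SameSalamonClass g.FI g'.FI) :
    ∃ φ : M → ℝ, ContMDiff 𝓘(ℝ, E) 𝓘(ℝ) ∞ φ ∧ g'.FI = g.FI + h.DDI φ := by
  obtain ⟨θ, hθ, hD⟩ := hclass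
  have hDx : ∀ x, salamonProj (h.I x) (h.J x) (h.K x) (extD θ x) = g.FI x - g'.FI x :=
    fun x => (congrFun hD x).symm
  have htype : ∀ x, extD θ x ∈ typeOneOne (h.I x) := fun x =>
    mem_typeOneOne_of_salamonProj_mem (h.quaternionic x) <| by
      rw [hDx]
      exact Submodule.sub_mem _ (g.FI_mem_typeOneOne x) (g'.FI_mem_typeOneOne x)
  have hneg : IsSmoothForm (-θ) := fun x₀ => by
    rw [inChart_neg]; exact (hθ x₀).neg
  obtain ⟨φ, hφ, hφθ⟩ := hdd (-θ) hneg fun x => by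
    rw [extD_neg]; exact Submodule.neg_mem _ (htype x)
  refine ⟨φ, hφ, ?_⟩
  funext x
  have h1 : h.DDI φ x = -(g.FI x - g'.FI x) := by
    rw [h.DDI_apply, ← hφθ, extD_neg, ← hDx]
    exact salamonProj_neg _
  rw [Pi.add_apply, h1]
  abel

end Forms

end HKT

theorem mainTheorem4
    {E : Type*} [NormedAddCommGroup E] [NormedSpace ℝ E] [FiniteDimensional ℝ E]
    {M : Type*} [TopologicalSpace M] [T2Space M] [CompactSpace M]
    [ChartedSpace E M] [IsManifold 𝓘(ℝ, E) ∞ M]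
    (h : HKT.HypercomplexStructure E M) (hdd : h.GlobalDDILemma)
    (g g' : HKT.HyperhermitianMetric h) (hg : g.IsHKT) (hg' : g'.IsHKT)
    (hclass : h.SameSalamonClass g.FI g'.FI) :
    (∃ φ : M → ℝ, ContMDiff 𝓘(ℝ, E) 𝓘(ℝ) ∞ φ ∧ g'.FI = g.FI + h.DDI φ) ∧
    (ConnectedSpace M → ∀ φ ψ : M → ℝ,
      ContMDiff 𝓘(ℝ, E) 𝓘(ℝ) ∞ φ → ContMDiff 𝓘(ℝ, E) 𝓘(ℝ) ∞ ψ →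
      g'.FI = g.FI + h.DDI φ → g'.FI = g.FI + h.DDI ψ →
      ∃ c : ℝ, ∀ x, ψ x = φ x + c) ∧
    (∀ φ : M → ℝ, ContMDiff 𝓘(ℝ, E) 𝓘(ℝ) ∞ φ → h.DDI φ = 0 →
      ∀ x, g.complexLaplacian φ x = 0) := by

  refine ⟨HKT.exists_potential hdd g g' hclass, fun _ φ ψ hφ hψ h1 h2 => ?_, fun φ _ h0 x => ?_⟩
  · have hzero : h.DDI (ψ - φ) = 0 := by
      rw [HKT.HypercomplexStructure.DDI_sub hψ hφ, sub_eq_zero]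
      exact add_left_cancel (h2.symm.trans h1)
    obtain ⟨c, hc⟩ := HKT.HypercomplexStructure.exists_eq_const_of_DDI_eq_zero (hψ.sub hφ) hzero
    exact ⟨c, fun x => by linarith [hc x, Pi.sub_apply ψ φ x]⟩
  · exact HKT.innerTwoForm_eq_zero _ (g.g x) (g.nondegenerate x) (g.inv_J x)
      (HKT.HypercomplexStructure.act_J_ddI h0 x) (g.act_J_FI x)
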